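/- There is an absolute constant $C>0$ such that the following holds. Let $n\ge 2$, let $\Theta$ be a finite nonempty set of $N$ features, let $H_0\in\mathbb R^{n\times n}$ be symmetric positive definite (the prior information matrix), let $\sigma>0$, and for every $f\in\Theta$ let $F_f\in\mathbb R^{m_f\times n}$ and $E_f\in\mathbb R^{m_f\times 3}$ be matrices with $E_f^TE_f$ invertible, and put $$H_f=\sigma^{-2}\bigl(F_f^TF_f-F_f^TE_f(E_f^TE_f)^{-1}E_f^TF_f\bigr).$$ For $\Phi\subset\Theta$ put $H(\Phi)=H_0+\sum_{f\in\Phi}H_f$; further let $\bar H_f=\frac1N H_0+H_f$ and $\pi_f=\frac1n\mathrm{Tr}\bigl(H(\Theta)^{-1}\bar H_f\bigr)$, which defines a probability mass function on $\Theta$. Let $\varepsilon\in(0,1)$ and let $q$ be an integer with $q\ge C\,n\log n/\varepsilon^2$. Draw $q$ features independently with replacement from $\pi$, and let $\Phi$ be the set of the features drawn. Define $\bar\chi$ as follows. Let $\bar H_f=\sum_{i=1}^n h_{f,i}h_{f,i}^T$ be any decomposition with pairwise orthogonal vectors $h_{f,1},\dots,h_{f,n}\in\mathbb R^n$, for every $f\in\Theta$,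 and let $\pi_{fi}=\frac1n\mathrm{Tr}\bigl(H(\Theta)^{-1}h_{f,i}h_{f,i}^T\bigr)$. Draw $q$ independent pairs $(f,i)$, where $f$ is drawn from $\pi$ and then $i$ with probability $\pi_{fi}/\sum_j\pi_{fj}$; let $\hat\Phi$ be the set of the pairs drawn, let $\phi_{fi}$ be the number of times that $(f,i)$ is drawn, and let $w(f,i)=\phi_{fi}/(q\,\pi_{fi})$. Then $$\chi=\inf\Bigl\{\gamma>0:\ \sum_{(f,i)\in\hat\Phi}w(f,i)\bigl(\gamma-w(f,i)\bigr)h_{f,i}h_{f,i}^T\succeq 0\Bigr\},\qquad \bar\chi=\mathbb E\,\chi .$$ For a positive definite information matrix $H$ let $\rho_v(H)=\mathrm{Tr}(H^{-1})$, $\rho_e(H)=\log\det(H^{-1})$ and $\rho_\lambda(H)=\lambda_{\max}(H^{-1})$. Then, with probability at least $1/4$, the following three inequalities hold simultaneously: $$\frac{\rho_v(H(\Phi))-\rho_v(H(\Theta))}{\rho_v(H(\Theta))}\le\frac{4\bar\chi}{1-\varepsilon}-1,\qquad \rho_e(H(\Phi))-\rho_e(H(\Theta))\le n\log\Bigl(\frac{4\bar\chi}{1-\varepsilon}\Bigr),\qquad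 \frac{\rho_\lambda(H(\Phi))-\rho_\lambda(H(\Theta))}{\rho_\lambda(H(\Theta))}\le\frac{4\bar\chi}{1-\varepsilon}-1 .$$ -/

import Mathlib

open Matrix

namespace FeatureSelection

noncomputable section

/-! ### Information matrices -/

/-- Information contributed to the state by one feature, after eliminating the unknown position
`y` of the feature from the linear Gaussian model `z = F x + E y + η`, `η ∼ N(0, σ² I)`:
`σ⁻² (Fᵀ F - Fᵀ E (Eᵀ E)⁻¹ Eᵀ F)`. -/
def featureInformation {n m : ℕ} (σ : ℝ) (F : Matrix (Fin m) (Fin n) ℝ)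
    (E : Matrix (Fin m) (Fin 3) ℝ) : Matrix (Fin n) (Fin n) ℝ :=
  (σ ^ 2)⁻¹ • (Fᵀ * F - Fᵀ * E * (Eᵀ * E)⁻¹ * Eᵀ * F)

section Selection

variable {n : ℕ} {Θ : Type*}

/-- The information matrix `H(Φ) = H₀ + ∑_{f ∈ Φ} H_f` of a set `Φ` of tracked features. -/
def infoMatrix (H₀ : Matrix (Fin n) (Fin n) ℝ) (H : Θ → Matrix (Fin n) (Fin n) ℝ)
    (Φ : Finset Θ) : Matrix (Fin n) (Fin n) ℝ :=
  H₀ + ∑ f ∈ Φ, H f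

/-- `H̄_f = H₀ / N + H_f`, where `N` is the number of all features. -/
def augmentedInfo [Fintype Θ] (H₀ : Matrix (Fin n) (Fin n) ℝ)
    (H : Θ → Matrix (Fin n) (Fin n) ℝ) (f : Θ) : Matrix (Fin n) (Fin n) ℝ :=
  (Fintype.card Θ : ℝ)⁻¹ • H₀ + H f

/-- The leverage score `r_f = Tr (H(Θ)⁻¹ H̄_f)`. -/
def leverage [Fintype Θ] (H₀ : Matrix (Fin n) (Fin n) ℝ)
    (H : Θ → Matrix (Fin n) (Fin n) ℝ) (f : Θ) : ℝ :=
  ((infoMatrix H₀ H Finset.univ)⁻¹ * augmentedInfo H₀ H f).trace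

/-- The sampling probability `π_f = r_f / n`. -/
def samplingProb [Fintype Θ] (H₀ : Matrix (Fin n) (Fin n) ℝ)
    (H : Θ → Matrix (Fin n) (Fin n) ℝ) (f : Θ) : ℝ :=
  leverage H₀ H f / n

/-! ### The randomized selection algorithm -/

/-- One pass of the loop: the state is the pair (selected features, information matrix), and `f` is
the feature just sampled. -/
def selectStep [DecidableEq Θ] (H : Θ → Matrix (Fin n) (Fin n) ℝ)
    (s : Finset Θ × Matrix (Fin n) (Fin n) ℝ) (f : Θ) :
    Finset Θ × Matrix (Fin n) (Fin n) ℝ :=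
  if f ∈ s.1 then s else (insert f s.1, s.2 + H f)

/-- The output of the algorithm when the `q` features that it samples are `ω 0, …, ω (q - 1)`. -/
def runSelection [DecidableEq Θ] (H₀ : Matrix (Fin n) (Fin n) ℝ)
    (H : Θ → Matrix (Fin n) (Fin n) ℝ) {q : ℕ} (ω : Fin q → Θ) :
    Finset Θ × Matrix (Fin n) (Fin n) ℝ :=
  (List.ofFn ω).foldl (selectStep H) (∅, H₀)

/-- The set `Φ` of features selected by the algorithm. -/
def selected [DecidableEq Θ] (H₀ : Matrix (Fin n) (Fin n) ℝ)
    (H : Θ → Matrix (Fin n) (Fin n) ℝ) {q : ℕ} (ω : Fin q → Θ) : Finset Θ :=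
  (runSelection H₀ H ω).1

/-- The information matrix returned by the algorithm is the one of the selected features. -/
theorem runSelection_snd [DecidableEq Θ] (H₀ : Matrix (Fin n) (Fin n) ℝ)
    (H : Θ → Matrix (Fin n) (Fin n) ℝ) {q : ℕ} (ω : Fin q → Θ) :
    (runSelection H₀ H ω).2 = infoMatrix H₀ H (selected H₀ H ω) := by
  have key : ∀ (l : List Θ) (s : Finset Θ × Matrix (Fin n) (Fin n) ℝ),
      s.2 = infoMatrix H₀ H s.1 →
      (l.foldl (selectStep H) s).2 = infoMatrix H₀ H (l.foldl (selectStep H) s).1 := by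
    intro l
    induction l with
    | nil => intro s hs; simpa using hs
    | cons f l ih =>
      intro s hs
      rw [List.foldl_cons]
      apply ih
      unfold selectStep
      split_ifs with hf
      · exact hs
      · simp only [infoMatrix] at hs ⊢
        rw [Finset.sum_insert hf, hs]
        abel
  exact key _ _ (by simp [infoMatrix])

end Selection

/-! ### Independent sampling from a finite set -/

/-- Probability of the event `A` for `q` independent draws from the mass function `p`. -/
def probSeq {α : Type*} [Fintype α] (p : α → ℝ) (q : ℕ) (A : Set (Fin q → α)) : ℝ :=
  open Classical in ∑ ω : Fin q → α, if ω ∈ A then ∏ k, p (ω k) else 0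

/-- Expectation of `X` for `q` independent draws from the mass function `p`. -/
def expectSeq {α : Type*} [Fintype α] (p : α → ℝ) (q : ℕ) (X : (Fin q → α) → ℝ) : ℝ :=
  ∑ ω : Fin q → α, (∏ k, p (ω k)) * X ω

/-! ### The number `χ̄` -/

section Chi

variable {n : ℕ} {Θ : Type*}

/-- `h f 1, …, h f n` are pairwise orthogonal vectors with `H̄_f = ∑ i, (h f i) (h f i)ᵀ`. -/
def IsOrthogonalDecomposition [Fintype Θ] (H₀ : Matrix (Fin n) (Fin n) ℝ)
    (H : Θ → Matrix (Fin n) (Fin n) ℝ) (h : Θ → Fin n → Fin n → ℝ) : Prop :=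
  ∀ f, (∀ i j, i ≠ j → h f i ⬝ᵥ h f j = 0) ∧
    augmentedInfo H₀ H f = ∑ i, vecMulVec (h f i) (h f i)

/-- The refined sampling number `π_{fi} = r_{fi} / n`, with the refined leverage score
`r_{fi} = Tr (H(Θ)⁻¹ (h f i) (h f i)ᵀ)`. -/
def refinedProb [Fintype Θ] (H₀ : Matrix (Fin n) (Fin n) ℝ)
    (H : Θ → Matrix (Fin n) (Fin n) ℝ) (h : Θ → Fin n → Fin n → ℝ) (a : Θ × Fin n) : ℝ :=
  ((infoMatrix H₀ H Finset.univ)⁻¹ * vecMulVec (h a.1 a.2) (h a.1 a.2)).trace / n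

/-- Mass function of a pair `(f, i)` in which `f` is drawn from `π` and then `i` from
`p_f = π_{f ·} / ∑ j, π_{fj}`. -/
def pairProb [Fintype Θ] (H₀ : Matrix (Fin n) (Fin n) ℝ)
    (H : Θ → Matrix (Fin n) (Fin n) ℝ) (h : Θ → Fin n → Fin n → ℝ) (a : Θ × Fin n) : ℝ :=
  samplingProb H₀ H a.1 *
    (refinedProb H₀ H h a / ∑ j, refinedProb H₀ H h (a.1, j))

/-- The weight `w(f, i) = φ_{fi} / (q π_{fi})`, with `φ_{fi}` the number of times that the pair
`(f, i)` occurs among the `q` draws. -/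
def weight [Fintype Θ] [DecidableEq Θ] (H₀ : Matrix (Fin n) (Fin n) ℝ)
    (H : Θ → Matrix (Fin n) (Fin n) ℝ) (h : Θ → Fin n → Fin n → ℝ) {q : ℕ}
    (ω : Fin q → Θ × Fin n) (a : Θ × Fin n) : ℝ :=
  ((Finset.univ.filter fun k => ω k = a).card : ℝ) * (q * refinedProb H₀ H h a)⁻¹

/-- `χ = inf {γ > 0 | ∑_{(f,i)} w(f,i) (γ - w(f,i)) (h f i) (h f i)ᵀ ⪰ 0}`, the sum being over the
pairs that have been drawn. -/
def chi [Fintype Θ] [DecidableEq Θ] (H₀ : Matrix (Fin n) (Fin n) ℝ)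
    (H : Θ → Matrix (Fin n) (Fin n) ℝ) (h : Θ → Fin n → Fin n → ℝ) {q : ℕ}
    (ω : Fin q → Θ × Fin n) : ℝ :=
  sInf {γ : ℝ | 0 < γ ∧
    (∑ a ∈ Finset.univ.image ω,
      (weight H₀ H h ω a * (γ - weight H₀ H h ω a)) •
        vecMulVec (h a.1 a.2) (h a.1 a.2)).PosSemidef}

/-- `χ̄ = 𝔼 χ` over `q` independent draws of pairs `(f, i)`. -/
def chiBar [Fintype Θ] [DecidableEq Θ] (H₀ : Matrix (Fin n) (Fin n) ℝ)
    (H : Θ → Matrix (Fin n) (Fin n) ℝ) (h : Θ → Fin n → Fin n → ℝ) (q : ℕ) : ℝ :=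
  expectSeq (pairProb H₀ H h) q (chi H₀ H h)

end Chi

/-! ### Estimation measures, as functions of the information matrix -/

/-- Variance of the error: the trace of the covariance matrix. -/
def rhoVar {n : ℕ} (M : Matrix (Fin n) (Fin n) ℝ) : ℝ := (M⁻¹).trace

/-- Entropy measure: the log-determinant of the covariance matrix. -/
def rhoEnt {n : ℕ} (M : Matrix (Fin n) (Fin n) ℝ) : ℝ := Real.log (M⁻¹).det

/-- Spectral variance: the largest eigenvalue of the covariance matrix. -/
def rhoMax {n : ℕ} (M : Matrix (Fin n) (Fin n) ℝ) : ℝ := sSup (spectrum ℝ M⁻¹)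

end

end FeatureSelection

/-!
Write `M = H(Θ)` and `π_a` for the refined probabilities. A single draw of a pair `a = (f, i)` has
law `π_a = hᵀ M⁻¹ h / n`, and its first coordinate has law `π_f`, so the set of features drawn may be
taken to be the set of first coordinates of the pairs drawn (`probSeq_fst_preimage`, `pairProb_eq`).

Two events suffice. First, by a lower matrix Chernoff bound, the importance-weighted sum
`∑ w(a) h hᵀ` over the pairs drawn is at least `(1 - ε) M` with probability at least `1/2`
(`probSeq_leverage_sampling_le`). Second, `χ ≤ 4 χ̄` with probability at least `3/4`, by Markov's
inequality. Both hold together with probability at least `1/4`. On their intersection, the definition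
of `χ` and the Cauchy–Schwarz inequality turn the weighted sum into an unweighted one at the price of
the factor `χ` (`sum_weight_mul_sq_le_chi_mul`), and the unweighted sum is at most `H(Φ)` because
`∑_{f ∈ Φ} H̄_f ≤ H(Φ)` (`sum_sq_le_quadForm_infoMatrix`). Hence `M ≤ κ H(Φ)` with
`κ = 4 χ̄ / (1 - ε)`, and all three measures are monotone in the inverse
(`measures_le_of_quadForm_le`).

The Chernoff bound is proved without the Golden–Thompson inequality. After whitening, the drawn
vectors satisfy `|v| ≤ 1` and `𝔼 v vᵀ = I / d`. The potential is `tr (A ^ (-P))` for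
`A = a I + ∑ v vᵀ`, with a large integer `P` and a shift `a` that is large compared to `P`. With
`B = A⁻¹` and `B' = (A + v vᵀ)⁻¹` the identity `B - B' = B v vᵀ B'` lets `B ^ P` be turned into
`B' ^ P` one factor at a time, and every exchange is controlled by a Chebyshev inequality for the
moments `vᵀ B ^ k v`; this shows that the potential drops by almost `P vᵀ B ^ (P + 1) v`
(`trace_inv_pow_add_vecMulVec_le`). On average it therefore decays at least as fast as
`d (a + c q / d) ^ (-P)` with `c` close to `1` (`expectSeq_trace_inv_pow_le`), and Markov's
inequality bounds the least eigenvalue of `A` from below (`probSeq_sampleSum_lt_le`).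
-/

namespace FeatureSelection

/-! ### Quadratic forms of symmetric matrices and of their powers -/

section QuadraticForms

variable {ι : Type*} [Fintype ι]

theorem dotProduct_mulVec_comm {M : Matrix ι ι ℝ} (hM : M.IsHermitian) (x y : ι → ℝ) :
    x ⬝ᵥ M *ᵥ y = y ⬝ᵥ M *ᵥ x := by
  have hT : Mᵀ = M := by simpa [IsHermitian, conjTranspose_eq_transpose_of_trivial] using hM
  rw [dotProduct_mulVec, ← mulVec_transpose, hT, dotProduct_comm]

theorem quadForm_nonneg {M : Matrix ι ι ℝ} (hM : M.PosSemidef) (x : ι → ℝ) :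
    0 ≤ x ⬝ᵥ M *ᵥ x := by
  simpa using hM.dotProduct_mulVec_nonneg x

theorem quadForm_vecMulVec (v x : ι → ℝ) : x ⬝ᵥ vecMulVec v v *ᵥ x = (v ⬝ᵥ x) ^ 2 := by
  rw [vecMulVec_mulVec]
  simp [dotProduct_comm x v, sq]

theorem trace_mul_vecMulVec_self (M : Matrix ι ι ℝ) (v : ι → ℝ) :
    (M * vecMulVec v v).trace = v ⬝ᵥ M *ᵥ v := by
  rw [mul_vecMulVec, trace_vecMulVec, dotProduct_comm]

theorem posSemidef_vecMulVec (v : ι → ℝ) : (vecMulVec v v).PosSemidef := by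
  simpa using posSemidef_vecMulVec_self_star v

variable [DecidableEq ι]

/-- Inversion is antitone for the Loewner order, up to a constant factor. -/
theorem inv_quadForm_le {P Q : Matrix ι ι ℝ} (hP : P.PosDef) (hQ : Q.PosDef) {c : ℝ} (hc : 0 < c)
    (h : ∀ x, x ⬝ᵥ P *ᵥ x ≤ c * (x ⬝ᵥ Q *ᵥ x)) (x : ι → ℝ) :
    x ⬝ᵥ Q⁻¹ *ᵥ x ≤ c * (x ⬝ᵥ P⁻¹ *ᵥ x) := by
  have hPu := (Matrix.isUnit_iff_isUnit_det P).1 hP.isUnit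
  have hQu := (Matrix.isUnit_iff_isUnit_det Q).1 hQ.isUnit
  set y := Q⁻¹ *ᵥ x with hy
  set z := P⁻¹ *ᵥ x with hz
  have hQy : Q *ᵥ y = x := by rw [hy, mulVec_mulVec, mul_nonsing_inv _ hQu, one_mulVec]
  have hPz : P *ᵥ z = x := by rw [hz, mulVec_mulVec, mul_nonsing_inv _ hPu, one_mulVec]
  -- The square of `y - c z` in the norm of `P` is nonnegative.
  have h1 := quadForm_nonneg hP.posSemidef (y - c • z)
  have h2 := h y
  rw [hQy] at h2
  have h3 : z ⬝ᵥ P *ᵥ y = x ⬝ᵥ y := by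
    rw [dotProduct_mulVec_comm hP.isHermitian, hPz, dotProduct_comm]
  simp only [mulVec_sub, mulVec_smul, dotProduct_sub, sub_dotProduct, smul_dotProduct,
    dotProduct_smul, smul_eq_mul, hPz, h3, dotProduct_comm y x, dotProduct_comm z x] at h1 h2 ⊢
  refine le_of_mul_le_mul_left ?_ hc
  nlinarith

/-- The spectral theorem for all powers of a real symmetric matrix at once. -/
theorem exists_diagonalization {B : Matrix ι ι ℝ} (hB : B.IsHermitian) :
    ∃ U : Matrix ι ι ℝ, Uᵀ * U = 1 ∧ U * Uᵀ = 1 ∧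
      ∀ k : ℕ, B ^ k = U * diagonal (fun i => hB.eigenvalues i ^ k) * Uᵀ := by
  have hU1 : (hB.eigenvectorUnitary : Matrix ι ι ℝ)ᵀ * hB.eigenvectorUnitary = 1 := by
    have := Unitary.coe_star_mul_self hB.eigenvectorUnitary
    rwa [star_eq_conjTranspose, conjTranspose_eq_transpose_of_trivial] at this
  have hU2 : (hB.eigenvectorUnitary : Matrix ι ι ℝ) * (hB.eigenvectorUnitary : Matrix ι ι ℝ)ᵀ = 1 :=
    mul_eq_one_comm.1 hU1
  refine ⟨hB.eigenvectorUnitary, hU1, hU2, fun k => ?_⟩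
  induction k with
  | zero => simp [hU2]
  | succ k ih =>
    have h1 : B = (hB.eigenvectorUnitary : Matrix ι ι ℝ) * diagonal hB.eigenvalues *
        (hB.eigenvectorUnitary : Matrix ι ι ℝ)ᵀ := by
      have := hB.spectral_theorem
      rw [Unitary.conjStarAlgAut_apply] at this
      rw [star_eq_conjTranspose, conjTranspose_eq_transpose_of_trivial] at this
      exact this
    rw [pow_succ, ih]
    nth_rewrite 4 [h1]
    rw [show ∀ U D V D' : Matrix ι ι ℝ, U * D * V * (U * D' * V) = U * D * (V * U) * D' * V by
      intros; simp only [Matrix.mul_assoc], hU1, Matrix.mul_one,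
      Matrix.mul_assoc _ (diagonal _) (diagonal _), diagonal_mul_diagonal]
    simp only [pow_succ]

theorem trace_pow_eq_sum {B : Matrix ι ι ℝ} (hB : B.IsHermitian) (k : ℕ) :
    (B ^ k).trace = ∑ i, hB.eigenvalues i ^ k := by
  obtain ⟨U, hU, -, hk⟩ := exists_diagonalization hB
  rw [hk, Matrix.mul_assoc, trace_mul_comm, Matrix.mul_assoc, hU, Matrix.mul_one, trace_diagonal]

theorem exists_quadForm_pow_eq_sum {B : Matrix ι ι ℝ} (hB : B.IsHermitian) (v : ι → ℝ) :
    ∃ w : ι → ℝ, (∀ i, 0 ≤ w i) ∧ ∀ k : ℕ, v ⬝ᵥ B ^ k *ᵥ v = ∑ i, w i * hB.eigenvalues i ^ k := by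
  obtain ⟨U, -, -, hk⟩ := exists_diagonalization hB
  refine ⟨fun i => (Uᵀ *ᵥ v) i ^ 2, fun i => sq_nonneg _, fun k => ?_⟩
  rw [hk, ← mulVec_mulVec, ← mulVec_mulVec, dotProduct_mulVec, ← mulVec_transpose]
  simp only [dotProduct, mulVec_diagonal]
  exact Finset.sum_congr rfl fun i _ => by ring

theorem eigenvalues_le_of_quadForm_le {B : Matrix ι ι ℝ} (hB : B.IsHermitian) {δ : ℝ}
    (h : ∀ x, x ⬝ᵥ B *ᵥ x ≤ δ * (x ⬝ᵥ x)) (i : ι) : hB.eigenvalues i ≤ δ := by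
  have h0 := h (hB.eigenvectorBasis i).ofLp
  have h1 : (hB.eigenvectorBasis i).ofLp ⬝ᵥ (hB.eigenvectorBasis i).ofLp = 1 := by
    have := hB.eigenvectorBasis.orthonormal.1 i
    have h2 := real_inner_self_eq_norm_sq (hB.eigenvectorBasis i)
    rw [this, EuclideanSpace.inner_eq_star_dotProduct] at h2
    simpa using h2
  rw [hB.mulVec_eigenvectorBasis] at h0
  simpa [h1] using h0

/-- The quadratic form is bounded by any bound on the eigenvalues. -/
theorem quadForm_le_of_eigenvalues_le {B : Matrix ι ι ℝ} (hB : B.IsHermitian) {δ : ℝ}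
    (h : ∀ i, hB.eigenvalues i ≤ δ) (x : ι → ℝ) : x ⬝ᵥ B *ᵥ x ≤ δ * (x ⬝ᵥ x) := by
  obtain ⟨w, hw, hk⟩ := exists_quadForm_pow_eq_sum hB x
  have h0 := hk 0
  have h1 := hk 1
  simp only [pow_zero, one_mulVec, mul_one, pow_one] at h0 h1
  rw [h0, h1, Finset.mul_sum]
  exact Finset.sum_le_sum fun i _ => by nlinarith [hw i, h i]

/-- The Chebyshev sum inequality for the moments `v ⬝ᵥ B ^ k *ᵥ v` of a symmetric matrix whose
eigenvalues lie in `[0, δ]`. -/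
theorem quadForm_pow_mul_le {B : Matrix ι ι ℝ} (hB : B.PosSemidef) {δ : ℝ} (hδ : 0 ≤ δ)
    (hBδ : ∀ x, x ⬝ᵥ B *ᵥ x ≤ δ * (x ⬝ᵥ x)) {v : ι → ℝ} (hv : v ⬝ᵥ v ≤ 1) (i j : ℕ) :
    (v ⬝ᵥ B ^ (i + 1) *ᵥ v) * (v ⬝ᵥ B ^ j *ᵥ v) ≤ δ * (v ⬝ᵥ B ^ (i + j) *ᵥ v) := by
  obtain ⟨w, hw, hk⟩ := exists_quadForm_pow_eq_sum hB.isHermitian v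
  have hl0 : ∀ l, 0 ≤ hB.isHermitian.eigenvalues l := hB.eigenvalues_nonneg
  have hl1 := eigenvalues_le_of_quadForm_le hB.isHermitian hBδ
  have hw1 : ∑ l, w l ≤ 1 := by
    have := hk 0
    simp only [pow_zero, one_mulVec, mul_one] at this
    rwa [← this]
  set d := hB.isHermitian.eigenvalues
  simp only [hk]
  have hnn : ∀ k : ℕ, 0 ≤ ∑ l, w l * d l ^ k := fun k =>
    Finset.sum_nonneg fun l _ => mul_nonneg (hw l) (pow_nonneg (hl0 l) k)
  have h1 : ∑ l, w l * d l ^ (i + 1) ≤ δ * ∑ l, w l * d l ^ i := by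
    rw [Finset.mul_sum]
    refine Finset.sum_le_sum fun l _ => ?_
    have : 0 ≤ w l * d l ^ i := mul_nonneg (hw l) (pow_nonneg (hl0 l) i)
    rw [pow_succ]
    nlinarith [hl1 l]
  have h2 : (∑ l, w l * d l ^ i) * (∑ l, w l * d l ^ j) ≤
      (∑ l, w l) * ∑ l, w l * d l ^ (i + j) := by
    have h3 : 0 ≤ ∑ l, ∑ m, w l * w m * ((d l ^ i - d m ^ i) * (d l ^ j - d m ^ j)) := by
      refine Finset.sum_nonneg fun l _ => Finset.sum_nonneg fun m _ =>
        mul_nonneg (mul_nonneg (hw l) (hw m)) ?_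
      rcases le_total (d l) (d m) with h | h
      · exact mul_nonneg_of_nonpos_of_nonpos
          (sub_nonpos.2 (pow_le_pow_left₀ (hl0 l) h i))
          (sub_nonpos.2 (pow_le_pow_left₀ (hl0 l) h j))
      · exact mul_nonneg (sub_nonneg.2 (pow_le_pow_left₀ (hl0 m) h i))
          (sub_nonneg.2 (pow_le_pow_left₀ (hl0 m) h j))
    have h4 : ∑ l, ∑ m, w l * w m * ((d l ^ i - d m ^ i) * (d l ^ j - d m ^ j)) =
        2 * ((∑ l, w l) * ∑ l, w l * d l ^ (i + j))
          - 2 * ((∑ l, w l * d l ^ i) * (∑ l, w l * d l ^ j)) := by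
      have e1 : ∀ l m, w l * w m * ((d l ^ i - d m ^ i) * (d l ^ j - d m ^ j)) =
          (w l * d l ^ (i + j)) * w m + w l * (w m * d m ^ (i + j))
          - (w l * d l ^ i) * (w m * d m ^ j) - (w l * d l ^ j) * (w m * d m ^ i) := by
        intro l m; ring
      simp only [e1, Finset.sum_sub_distrib, Finset.sum_add_distrib, ← Finset.sum_mul_sum]
      ring
    linarith
  calc _ ≤ δ * (∑ l, w l * d l ^ i) * (∑ l, w l * d l ^ j) :=
        mul_le_mul_of_nonneg_right h1 (hnn j)
    _ = δ * ((∑ l, w l * d l ^ i) * (∑ l, w l * d l ^ j)) := by ring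
    _ ≤ δ * (∑ l, w l * d l ^ (i + j)) := by
        refine mul_le_mul_of_nonneg_left (h2.trans ?_) hδ
        exact mul_le_of_le_one_left (hnn _) hw1

end QuadraticForms

/-! ### Trace powers of the inverse under a rank-one update -/

section RankOneUpdate

variable {ι : Type*} [Fintype ι] [DecidableEq ι]

/-- The hypothesis `B - B' = B v vᵀ B'` is satisfied by `B = A⁻¹` and `B' = (A + v vᵀ)⁻¹`. -/
theorem pow_mul_pow_succ_eq {B B' : Matrix ι ι ℝ} {v : ι → ℝ}
    (hBB : B - B' = B * vecMulVec v v * B') (i j : ℕ) :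
    B ^ i * B' ^ (j + 1) =
      B ^ (i + 1) * B' ^ j - B ^ (i + 1) * vecMulVec v v * B' ^ (j + 1) := by
  calc B ^ i * B' ^ (j + 1) = B ^ i * (B - (B - B')) * B' ^ j := by
        rw [sub_sub_cancel, pow_succ', Matrix.mul_assoc]
    _ = B ^ i * (B - B * vecMulVec v v * B') * B' ^ j := by rw [hBB]
    _ = _ := by
        rw [pow_succ, pow_succ']
        noncomm_ring

/-- Replacing a factor `B` by `B'` in a mixed moment costs a product of two moments. -/
theorem mixedMoment_succ {B B' : Matrix ι ι ℝ} {v : ι → ℝ}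
    (hBB : B - B' = B * vecMulVec v v * B') (i j : ℕ) :
    v ⬝ᵥ (B ^ i * B' ^ (j + 1)) *ᵥ v = v ⬝ᵥ (B ^ (i + 1) * B' ^ j) *ᵥ v -
      (v ⬝ᵥ B ^ (i + 1) *ᵥ v) * (v ⬝ᵥ B' ^ (j + 1) *ᵥ v) := by
  rw [pow_mul_pow_succ_eq hBB, sub_mulVec, dotProduct_sub, ← mulVec_mulVec v _ (B' ^ (j + 1)),
    ← mulVec_mulVec (B' ^ (j + 1) *ᵥ v), vecMulVec_mulVec]
  simp [mulVec_smul, mul_comm]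

theorem mixedMoment_le {B B' : Matrix ι ι ℝ} (hB : B.PosSemidef) (hB' : B'.PosSemidef) {v : ι → ℝ}
    (hBB : B - B' = B * vecMulVec v v * B') (i j : ℕ) :
    v ⬝ᵥ (B ^ i * B' ^ j) *ᵥ v ≤ v ⬝ᵥ B ^ (i + j) *ᵥ v := by
  induction j generalizing i with
  | zero => simp
  | succ j ih =>
    rw [mixedMoment_succ hBB]
    have h1 := ih (i + 1)
    have h2 := mul_nonneg (quadForm_nonneg (hB.pow (i + 1)) v) (quadForm_nonneg (hB'.pow (j + 1)) v)
    rw [show i + 1 + j = i + (j + 1) by ring] at h1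
    linarith

theorem le_mixedMoment {B B' : Matrix ι ι ℝ} (hB : B.PosSemidef) (hB' : B'.PosSemidef) {v : ι → ℝ}
    (hBB : B - B' = B * vecMulVec v v * B') {δ : ℝ} (hδ : 0 ≤ δ)
    (hBδ : ∀ x, x ⬝ᵥ B *ᵥ x ≤ δ * (x ⬝ᵥ x)) (hv : v ⬝ᵥ v ≤ 1) (i j : ℕ) :
    (1 - j * δ) * (v ⬝ᵥ B ^ (i + j) *ᵥ v) ≤ v ⬝ᵥ (B ^ i * B' ^ j) *ᵥ v := by
  induction j generalizing i with
  | zero => simp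
  | succ j ih =>
    rw [mixedMoment_succ hBB]
    have h1 := ih (i + 1)
    have h2 := mixedMoment_le hB hB' hBB 0 (j + 1)
    simp only [pow_zero, Matrix.one_mul, zero_add] at h2
    have h3 := mul_le_mul_of_nonneg_left h2 (quadForm_nonneg (hB.pow (i + 1)) v)
    have h4 := quadForm_pow_mul_le hB hδ hBδ hv i (j + 1)
    rw [show i + 1 + j = i + (j + 1) by ring] at h1
    push_cast
    linarith

/-- One exchange of `B` for `B'` at a time, from `tr (B ^ (i + j))` to `tr (B ^ i * B' ^ j)`. -/
theorem trace_pow_mul_pow_le {B B' : Matrix ι ι ℝ} (hB : B.PosSemidef) (hB' : B'.PosSemidef)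
    {v : ι → ℝ} (hBB : B - B' = B * vecMulVec v v * B') {δ : ℝ} (hδ : 0 ≤ δ)
    (hBδ : ∀ x, x ⬝ᵥ B *ᵥ x ≤ δ * (x ⬝ᵥ x)) (hv : v ⬝ᵥ v ≤ 1) (i j : ℕ) :
    (B ^ i * B' ^ j).trace ≤ (B ^ (i + j)).trace -
      j * (1 - (j + 1) / 2 * δ) * (v ⬝ᵥ B ^ (i + j + 1) *ᵥ v) := by
  induction j generalizing i with
  | zero => simp
  | succ j ih =>
    have h1 := ih (i + 1)
    have h2 := le_mixedMoment hB hB' hBB hδ hBδ hv (i + 1) (j + 1)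
    have h3 : (B ^ i * B' ^ (j + 1)).trace =
        (B ^ (i + 1) * B' ^ j).trace - v ⬝ᵥ (B ^ (i + 1) * B' ^ (j + 1)) *ᵥ v := by
      rw [pow_mul_pow_succ_eq hBB, trace_sub, trace_mul_comm (B ^ (i + 1) * vecMulVec v v),
        ← Matrix.mul_assoc, trace_mul_vecMulVec_self, ← mulVec_mulVec, ← mulVec_mulVec,
        dotProduct_mulVec_comm (hB.pow (i + 1)).isHermitian v,
        dotProduct_mulVec_comm (hB'.pow (j + 1)).isHermitian v, dotProduct_comm]
    rw [show i + 1 + j = i + (j + 1) by ring] at h1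
    rw [show i + 1 + (j + 1) = i + (j + 1) + 1 by ring] at h2
    push_cast at h2 ⊢
    rw [h3]
    linarith

/-- The rank-one step: when `A ≥ a` and `|v| ≤ 1`, adding `v vᵀ` to `A` lowers `tr (A ^ (-p))` by
almost as much as its linearization `p * vᵀ A ^ (-p-1) v`. -/
theorem trace_inv_pow_add_vecMulVec_le {A : Matrix ι ι ℝ} (hA : A.PosDef) {a : ℝ} (ha : 0 < a)
    (hAa : ∀ x, a * (x ⬝ᵥ x) ≤ x ⬝ᵥ A *ᵥ x) {v : ι → ℝ} (hv : v ⬝ᵥ v ≤ 1) (p : ℕ) :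
    ((A + vecMulVec v v)⁻¹ ^ p).trace ≤ (A⁻¹ ^ p).trace -
      p * (1 - (p + 1) / (2 * a)) * (v ⬝ᵥ A⁻¹ ^ (p + 1) *ᵥ v) := by
  have hA' : (A + vecMulVec v v).PosDef := hA.add_posSemidef (posSemidef_vecMulVec v)
  have hu := (Matrix.isUnit_iff_isUnit_det _).1 hA.isUnit
  have hu' := (Matrix.isUnit_iff_isUnit_det _).1 hA'.isUnit
  have hBB : A⁻¹ - (A + vecMulVec v v)⁻¹ = A⁻¹ * vecMulVec v v * (A + vecMulVec v v)⁻¹ := by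
    calc A⁻¹ - (A + vecMulVec v v)⁻¹
        = A⁻¹ * ((A + vecMulVec v v) * (A + vecMulVec v v)⁻¹)
          - (A⁻¹ * A) * (A + vecMulVec v v)⁻¹ := by
          rw [mul_nonsing_inv _ hu', nonsing_inv_mul _ hu, Matrix.mul_one, Matrix.one_mul]
      _ = _ := by
          generalize (A + vecMulVec v v)⁻¹ = Z
          noncomm_ring
  have hBδ : ∀ x, x ⬝ᵥ A⁻¹ *ᵥ x ≤ a⁻¹ * (x ⬝ᵥ x) := by
    intro x
    have := inv_quadForm_le (P := (1 : Matrix ι ι ℝ)) PosDef.one hA (c := a⁻¹) (by positivity)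
      (fun y => by
        rw [one_mulVec, inv_mul_eq_div, le_div_iff₀ ha, mul_comm]
        exact hAa y) x
    simpa using this
  have h := trace_pow_mul_pow_le hA.inv.posSemidef hA'.inv.posSemidef hBB
    (inv_pos.2 ha).le hBδ hv 0 p
  simp only [pow_zero, Matrix.one_mul, zero_add] at h
  rwa [show ((p : ℝ) + 1) / 2 * a⁻¹ = (p + 1) / (2 * a) by field_simp] at h

/-- The tangent line of `x ↦ x ^ (p + 1)` as a function of `x ^ p`, summed over the eigenvalues. -/
theorem trace_pow_succ_ge {B : Matrix ι ι ℝ} (hB : B.PosSemidef) {t : ℝ} (ht : 0 ≤ t) (p : ℕ) :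
    (p + 1) * t * (B ^ p).trace - Fintype.card ι * t ^ (p + 1) ≤ p * (B ^ (p + 1)).trace := by
  rw [trace_pow_eq_sum hB.isHermitian, trace_pow_eq_sum hB.isHermitian, Finset.mul_sum,
    Finset.mul_sum, ← nsmul_eq_mul, Fintype.card, ← Finset.sum_const, ← Finset.sum_sub_distrib]
  refine Finset.sum_le_sum fun i _ => ?_
  have key : ∀ x : ℝ, 0 ≤ x → ∀ p : ℕ,
      ((p : ℝ) + 1) * t * x ^ p - t ^ (p + 1) ≤ p * x ^ (p + 1) := by
    intro x hx p
    induction p with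
    | zero => simp
    | succ p ih =>
      have h1 := mul_le_mul_of_nonneg_left ih ht
      have h2 : 0 ≤ ((p : ℝ) + 1) * x ^ p * (x - t) ^ 2 := by positivity
      push_cast
      ring_nf at h1 h2 ⊢
      linarith
  exact key _ (hB.eigenvalues_nonneg i) p

end RankOneUpdate

/-! ### Independent draws from a finite mass function -/

section Draws

variable {α : Type*} [Fintype α] {p : α → ℝ} {q : ℕ}

theorem expectSeq_mono (hp : ∀ a, 0 ≤ p a) {X Y : (Fin q → α) → ℝ} (h : ∀ ω, X ω ≤ Y ω) :
    expectSeq p q X ≤ expectSeq p q Y :=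
  Finset.sum_le_sum fun ω _ =>
    mul_le_mul_of_nonneg_left (h ω) (Finset.prod_nonneg fun k _ => hp (ω k))

theorem expectSeq_one (hp1 : ∑ a, p a = 1) : expectSeq p q (fun _ => 1) = 1 := by
  classical
  simp only [expectSeq, mul_one]
  rw [← Fintype.piFinset_univ, ← Finset.prod_univ_sum]
  simp [hp1]

theorem expectSeq_mul_add_const (hp1 : ∑ a, p a = 1) (X : (Fin q → α) → ℝ) (b c : ℝ) :
    expectSeq p q (fun ω => b * X ω + c) = b * expectSeq p q X + c := by
  have h1 := expectSeq_one (q := q) hp1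
  simp only [expectSeq, mul_one] at h1 ⊢
  calc ∑ ω : Fin q → α, (∏ k, p (ω k)) * (b * X ω + c)
      = ∑ ω : Fin q → α, (b * ((∏ k, p (ω k)) * X ω) + (∏ k, p (ω k)) * c) :=
        Finset.sum_congr rfl fun ω _ => by ring
    _ = _ := by rw [Finset.sum_add_distrib, ← Finset.mul_sum, ← Finset.sum_mul, h1, one_mul]

/-- Conditioning on all draws but the first one. -/
theorem expectSeq_succ (X : (Fin (q + 1) → α) → ℝ) :
    expectSeq p (q + 1) X = expectSeq p q (fun ω => ∑ a, p a * X (Fin.cons a ω)) := by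
  simp only [expectSeq]
  rw [← (Fin.consEquiv (fun _ : Fin (q + 1) => α)).sum_comp, Fintype.sum_prod_type,
    Finset.sum_comm]
  refine Finset.sum_congr rfl fun ω _ => ?_
  rw [Finset.mul_sum]
  refine Finset.sum_congr rfl fun a _ => ?_
  simp only [Fin.consEquiv, Equiv.coe_fn_mk, Fin.prod_univ_succ, Fin.cons_zero, Fin.cons_succ]
  ring

open Classical in
theorem probSeq_eq_expectSeq (A : Set (Fin q → α)) :
    probSeq p q A = expectSeq p q (fun ω => if ω ∈ A then 1 else 0) := by
  simp [probSeq, expectSeq]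

theorem probSeq_mono (hp : ∀ a, 0 ≤ p a) {A B : Set (Fin q → α)} (h : A ⊆ B) :
    probSeq p q A ≤ probSeq p q B := by
  classical
  rw [probSeq_eq_expectSeq, probSeq_eq_expectSeq]
  refine expectSeq_mono hp fun ω => ?_
  by_cases hA : ω ∈ A
  · simp [hA, h hA]
  · simp only [hA, if_false]
    split_ifs <;> simp

/-- The union bound for two exceptional events. -/
theorem one_sub_sub_le_probSeq (hp : ∀ a, 0 ≤ p a) (hp1 : ∑ a, p a = 1)
    {A B C : Set (Fin q → α)} {b c : ℝ} (hB : probSeq p q B ≤ b) (hC : probSeq p q C ≤ c)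
    (h : ∀ ω, ω ∉ B → ω ∉ C → ω ∈ A) : 1 - b - c ≤ probSeq p q A := by
  classical
  suffices 1 ≤ probSeq p q A + probSeq p q B + probSeq p q C by linarith
  rw [← expectSeq_one (q := q) hp1]
  simp only [probSeq, expectSeq, mul_one]
  rw [← Finset.sum_add_distrib, ← Finset.sum_add_distrib]
  refine Finset.sum_le_sum fun ω _ => ?_
  have h0 : 0 ≤ ∏ k, p (ω k) := Finset.prod_nonneg fun k _ => hp (ω k)
  have hω := h ω
  split_ifs <;> first | linarith | tauto

/-- Markov's inequality, also valid when the expectation vanishes. -/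
theorem probSeq_mul_expectSeq_lt_le (hp : ∀ a, 0 ≤ p a) {X : (Fin q → α) → ℝ}
    (hX : ∀ ω, 0 ≤ X ω) {c : ℝ} (hc : 0 < c) :
    probSeq p q {ω | c * expectSeq p q X < X ω} ≤ 1 / c := by
  classical
  have hprod : ∀ ω : Fin q → α, 0 ≤ ∏ k, p (ω k) := fun ω => Finset.prod_nonneg fun k _ => hp (ω k)
  have hterm : ∀ ω : Fin q → α, 0 ≤ (∏ k, p (ω k)) * X ω := fun ω => mul_nonneg (hprod ω) (hX ω)
  have hE0 : 0 ≤ expectSeq p q X := Finset.sum_nonneg fun ω _ => hterm ω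
  rcases hE0.eq_or_lt with hE | hE
  · have hz : ∀ ω, (∏ k, p (ω k)) * X ω = 0 := fun ω =>
      (Finset.sum_eq_zero_iff_of_nonneg fun ω _ => hterm ω).1 hE.symm ω (Finset.mem_univ _)
    have : probSeq p q {ω | c * expectSeq p q X < X ω} = 0 := by
      refine Finset.sum_eq_zero fun ω _ => ?_
      split_ifs with h
      · rw [Set.mem_ofPred_eq, ← hE, mul_zero] at h
        exact (mul_eq_zero.1 (hz ω)).resolve_right h.ne'
      · rfl
    rw [this]
    positivity
  · rw [le_div_iff₀ hc]
    refine le_of_mul_le_mul_right ?_ hE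
    rw [one_mul, mul_assoc, probSeq, Finset.sum_mul]
    refine Finset.sum_le_sum fun ω _ => ?_
    split_ifs with h
    · exact mul_le_mul_of_nonneg_left (le_of_lt h) (hprod ω)
    · rw [zero_mul]; exact hterm ω

/-- Independent draws of pairs give independent draws of first coordinates, from the marginal. -/
theorem probSeq_fst_preimage {β : Type*} [Fintype β] {r : α × β → ℝ}
    (hr : ∀ a, ∑ b, r (a, b) = p a) (A : Set (Fin q → α)) :
    probSeq r q {ω | (fun k => (ω k).1) ∈ A} = probSeq p q A := by
  classical
  unfold probSeq
  rw [← (Equiv.arrowProdEquivProdArrow (Fin q) (fun _ => α) (fun _ => β)).symm.sum_comp,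
    Fintype.sum_prod_type]
  refine Finset.sum_congr rfl fun ω _ => ?_
  calc _ = ∑ y : Fin q → β, if ω ∈ A then ∏ k, r (ω k, y k) else 0 := rfl
    _ = _ := by
      split_ifs with h
      · rw [← Fintype.piFinset_univ, ← Finset.prod_univ_sum (fun _ => Finset.univ)
          (fun k b => r (ω k, b))]
        exact Finset.prod_congr rfl fun k _ => hr (ω k)
      · simp

end Draws

/-! ### A lower matrix Chernoff bound for sums of rank-one matrices -/

section Chernoff

variable {ι α : Type*}

/-- The sum of the rank-one matrices `v vᵀ` of the drawn vectors. -/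
noncomputable def sampleSum {q : ℕ} (v : α → ι → ℝ) (ω : Fin q → α) : Matrix ι ι ℝ :=
  ∑ k, vecMulVec (v (ω k)) (v (ω k))

theorem posSemidef_sampleSum [Fintype ι] {q : ℕ} (v : α → ι → ℝ) (ω : Fin q → α) :
    (sampleSum v ω).PosSemidef :=
  posSemidef_sum _ fun _ _ => posSemidef_vecMulVec _

theorem sampleSum_cons {q : ℕ} (v : α → ι → ℝ) (a : α) (ω : Fin q → α) :
    sampleSum v (Fin.cons a ω : Fin (q + 1) → α) = sampleSum v ω + vecMulVec (v a) (v a) := by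
  simp [sampleSum, Fin.sum_univ_succ, add_comm]

theorem posDef_smul_one_add [DecidableEq ι] {a : ℝ} (ha : 0 < a) {S : Matrix ι ι ℝ} (hS : S.PosSemidef) :
    (a • (1 : Matrix ι ι ℝ) + S).PosDef :=
  (PosDef.one.smul ha).add_posSemidef hS

variable [Fintype ι]

theorem quadForm_sampleSum {q : ℕ} (v : α → ι → ℝ) (ω : Fin q → α) (x : ι → ℝ) :
    x ⬝ᵥ sampleSum v ω *ᵥ x = ∑ k, (v (ω k) ⬝ᵥ x) ^ 2 := by
  simp only [sampleSum, sum_mulVec, dotProduct_sum, quadForm_vecMulVec]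

variable [DecidableEq ι]

theorem quadForm_smul_one_add (a : ℝ) (S : Matrix ι ι ℝ) (x : ι → ℝ) :
    x ⬝ᵥ (a • (1 : Matrix ι ι ℝ) + S) *ᵥ x = a * (x ⬝ᵥ x) + x ⬝ᵥ S *ᵥ x := by
  simp [add_mulVec, smul_mulVec]

variable [Fintype α] [Nonempty ι]

/-- The potential `tr (A ^ (-P))` after one random rank-one update of `A ≥ a` whose mean is
`1 / d`, linearized at `t`. -/
theorem sum_mul_trace_inv_pow_le {p : α → ℝ} (hp : ∀ a, 0 ≤ p a) (hp1 : ∑ a, p a = 1)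
    {v : α → ι → ℝ} (hv : ∀ a, v a ⬝ᵥ v a ≤ 1)
    (hE : ∑ a, p a • vecMulVec (v a) (v a) = (Fintype.card ι : ℝ)⁻¹ • (1 : Matrix ι ι ℝ))
    {A : Matrix ι ι ℝ} (hA : A.PosDef) {a : ℝ} (ha : 0 < a)
    (hAa : ∀ x, a * (x ⬝ᵥ x) ≤ x ⬝ᵥ A *ᵥ x) (P : ℕ) {c : ℝ} (hc : c = 1 - (P + 1) / (2 * a))
    (hc0 : 0 ≤ c) {t : ℝ} (ht : 0 ≤ t) :
    ∑ b, p b * ((A + vecMulVec (v b) (v b))⁻¹ ^ P).trace ≤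
      (1 - c * (P + 1) * t / Fintype.card ι) * (A⁻¹ ^ P).trace + c * t ^ (P + 1) := by
  have hd : (0 : ℝ) < Fintype.card ι := by exact_mod_cast Fintype.card_pos
  have h1 : ∑ b, p b * (v b ⬝ᵥ A⁻¹ ^ (P + 1) *ᵥ v b) =
      (Fintype.card ι : ℝ)⁻¹ * (A⁻¹ ^ (P + 1)).trace := by
    calc ∑ b, p b * (v b ⬝ᵥ A⁻¹ ^ (P + 1) *ᵥ v b)
        = (A⁻¹ ^ (P + 1) * ∑ b, p b • vecMulVec (v b) (v b)).trace := by
          rw [Matrix.mul_sum, trace_sum]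
          refine Finset.sum_congr rfl fun b _ => ?_
          rw [Matrix.mul_smul, trace_smul, trace_mul_vecMulVec_self, smul_eq_mul]
      _ = _ := by rw [hE, Matrix.mul_smul, Matrix.mul_one, trace_smul, smul_eq_mul]
  have h2 : ∑ b, p b * ((A + vecMulVec (v b) (v b))⁻¹ ^ P).trace ≤
      (A⁻¹ ^ P).trace - P * c * ((Fintype.card ι : ℝ)⁻¹ * (A⁻¹ ^ (P + 1)).trace) := by
    calc ∑ b, p b * ((A + vecMulVec (v b) (v b))⁻¹ ^ P).trace
        ≤ ∑ b, p b * ((A⁻¹ ^ P).trace - P * c * (v b ⬝ᵥ A⁻¹ ^ (P + 1) *ᵥ v b)) :=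
          Finset.sum_le_sum fun b _ => mul_le_mul_of_nonneg_left
            (hc ▸ trace_inv_pow_add_vecMulVec_le hA ha hAa (hv b) P) (hp b)
      _ = (∑ b, p b) * (A⁻¹ ^ P).trace -
            P * c * ∑ b, p b * (v b ⬝ᵥ A⁻¹ ^ (P + 1) *ᵥ v b) := by
          rw [Finset.sum_mul, Finset.mul_sum, ← Finset.sum_sub_distrib]
          exact Finset.sum_congr rfl fun b _ => by ring
      _ = _ := by rw [hp1, one_mul, h1]
  have h3 := mul_le_mul_of_nonneg_left (trace_pow_succ_ge hA.inv.posSemidef ht P)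
    (div_nonneg hc0 hd.le)
  refine h2.trans ?_
  have e1 : c / Fintype.card ι * ((P + 1) * t * (A⁻¹ ^ P).trace - Fintype.card ι * t ^ (P + 1)) =
      c * (P + 1) * t / Fintype.card ι * (A⁻¹ ^ P).trace - c * t ^ (P + 1) := by
    field_simp
  rw [e1] at h3
  have e2 : P * c * ((Fintype.card ι : ℝ)⁻¹ * (A⁻¹ ^ (P + 1)).trace) =
      c / Fintype.card ι * (P * (A⁻¹ ^ (P + 1)).trace) := by
    field_simp
  rw [e2]
  linarith

/-- In expectation, `tr (A ^ (-P))` decays as if every draw added `c / d` to each eigenvalue. -/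
theorem expectSeq_trace_inv_pow_le {p : α → ℝ} (hp : ∀ a, 0 ≤ p a) (hp1 : ∑ a, p a = 1)
    {v : α → ι → ℝ} (hv : ∀ a, v a ⬝ᵥ v a ≤ 1)
    (hE : ∑ a, p a • vecMulVec (v a) (v a) = (Fintype.card ι : ℝ)⁻¹ • (1 : Matrix ι ι ℝ))
    {a : ℝ} (P : ℕ) (haP : P + 1 ≤ a) {c : ℝ} (hc : c = 1 - (P + 1) / (2 * a)) (q : ℕ) :
    expectSeq p q (fun ω => ((a • (1 : Matrix ι ι ℝ) + sampleSum v ω)⁻¹ ^ P).trace) ≤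
      Fintype.card ι * (a + c * q / Fintype.card ι)⁻¹ ^ P := by
  have hd : (1 : ℝ) ≤ Fintype.card ι := by exact_mod_cast Fintype.card_pos
  have hd0 : (0 : ℝ) < Fintype.card ι := by linarith
  have hP : (0 : ℝ) < P + 1 := by positivity
  have ha : 0 < a := by linarith
  have hc1 : c ≤ 1 := by
    rw [hc]
    have : 0 ≤ (P + 1) / (2 * a) := by positivity
    linarith
  have hc0 : 0 ≤ c := by
    rw [hc, sub_nonneg, div_le_one (by positivity)]
    linarith
  induction q with
  | zero =>
    simp only [expectSeq, sampleSum, Finset.univ_eq_empty, Finset.prod_empty, Finset.sum_empty,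
      add_zero, one_mul, Finset.univ_unique, Finset.sum_singleton, Nat.cast_zero, mul_zero, zero_div]
    have e1 : (a • (1 : Matrix ι ι ℝ))⁻¹ = a⁻¹ • 1 :=
      inv_eq_right_inv (by simp [smul_smul, ha.ne'])
    rw [e1, smul_pow, one_pow, trace_smul, trace_one, smul_eq_mul, mul_comm]
  | succ q ih =>
    set s := a + c * q / Fintype.card ι with hs
    have hcq : 0 ≤ c * q / Fintype.card ι := by positivity
    have hsa : a ≤ s := by rw [hs]; linarith
    have hs0 : 0 < s := by linarith
    have hcoef : 0 ≤ 1 - c * (P + 1) * s⁻¹ / Fintype.card ι := by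
      rw [sub_nonneg, div_le_one hd0, ← div_eq_mul_inv, div_le_iff₀ hs0]
      have : c * (P + 1) ≤ P + 1 := mul_le_of_le_one_left hP.le hc1
      nlinarith
    rw [expectSeq_succ]
    have hstep : ∀ ω : Fin q → α,
        ∑ b, p b * ((a • (1 : Matrix ι ι ℝ) + sampleSum v (Fin.cons b ω : Fin (q + 1) → α))⁻¹
          ^ P).trace ≤ (1 - c * (P + 1) * s⁻¹ / Fintype.card ι) *
          ((a • (1 : Matrix ι ι ℝ) + sampleSum v ω)⁻¹ ^ P).trace + c * s⁻¹ ^ (P + 1) := by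
      intro ω
      simp only [sampleSum_cons, ← add_assoc]
      refine sum_mul_trace_inv_pow_le hp hp1 hv hE
        (posDef_smul_one_add ha (posSemidef_sampleSum v ω)) ha (fun x => ?_) P hc hc0
        (inv_nonneg.2 hs0.le)
      rw [quadForm_smul_one_add]
      linarith [quadForm_nonneg (posSemidef_sampleSum v ω) x]
    refine (expectSeq_mono hp hstep).trans ?_
    rw [expectSeq_mul_add_const hp1]
    refine (add_le_add_left (mul_le_mul_of_nonneg_left ih hcoef) _).trans ?_
    -- Bernoulli: `(s + c / d) ^ (-P) ≥ s ^ (-P) * (1 - c / (d s)) ^ P`.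
    set y := c * s⁻¹ / Fintype.card ι with hy
    have hy0 : 0 ≤ y := by positivity
    have hy1 : y ≤ 1 := by
      rw [hy, div_le_one hd0, ← div_eq_mul_inv, div_le_iff₀ hs0]
      nlinarith [(Nat.cast_nonneg P : (0 : ℝ) ≤ P)]
    have hb := one_add_mul_le_pow (a := -y) (by linarith) P
    have hs' : a + c * ((q + 1 : ℕ) : ℝ) / Fintype.card ι = s * (1 + y) := by
      rw [hy, hs]
      push_cast
      field_simp
      ring
    have hinv : 1 + -y ≤ (1 + y)⁻¹ := by
      rw [← one_div, le_div_iff₀ (by linarith)]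
      nlinarith
    have hpow : (1 + -y) ^ P ≤ (1 + y)⁻¹ ^ P := pow_le_pow_left₀ (by linarith) hinv P
    rw [hs', mul_inv, mul_pow]
    have e1 : (1 - c * (P + 1) * s⁻¹ / Fintype.card ι) * (Fintype.card ι * s⁻¹ ^ P)
        + c * s⁻¹ ^ (P + 1) = Fintype.card ι * (s⁻¹ ^ P * (1 + P * -y)) := by
      rw [hy, pow_succ]
      field_simp
      ring
    rw [e1]
    gcongr
    exact hb.trans hpow

end Chernoff

section ChernoffTail

variable {ι α : Type*} [Fintype ι] [DecidableEq ι] [Fintype α]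

theorem le_quadForm_of_trace_inv_pow_le {A : Matrix ι ι ℝ} (hA : A.PosDef) {τ : ℝ} (hτ : 0 < τ)
    {P : ℕ} (hP : P ≠ 0) (h : (A⁻¹ ^ P).trace ≤ τ⁻¹ ^ P) (x : ι → ℝ) :
    τ * (x ⬝ᵥ x) ≤ x ⬝ᵥ A *ᵥ x := by
  have hB := hA.inv.posSemidef
  have h1 : ∀ i, hB.isHermitian.eigenvalues i ≤ τ⁻¹ := fun i => by
    rw [trace_pow_eq_sum hB.isHermitian] at h
    refine le_of_pow_le_pow_left₀ hP (inv_nonneg.2 hτ.le) (le_trans ?_ h)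
    exact Finset.single_le_sum (f := fun i => hB.isHermitian.eigenvalues i ^ P)
      (fun j _ => pow_nonneg (hB.eigenvalues_nonneg j) P) (Finset.mem_univ i)
  have h2 := inv_quadForm_le hA.inv PosDef.one (inv_pos.2 hτ)
    (fun y => by simpa using quadForm_le_of_eigenvalues_le hB.isHermitian h1 y) x
  rw [nonsing_inv_nonsing_inv _ ((Matrix.isUnit_iff_isUnit_det _).1 hA.isUnit), inv_one,
    one_mulVec, inv_mul_eq_div, le_div_iff₀ hτ] at h2
  linarith

/-- The lower matrix Chernoff bound: if `|v| ≤ 1` and `𝔼 v vᵀ = I / d` then `q ≥ 20 d log d / ε²`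
draws suffice for `∑ v vᵀ ≥ (1 - ε) q / d` with probability at least one half. -/
theorem probSeq_sampleSum_lt_le [Nonempty ι] {p : α → ℝ} (hp : ∀ a, 0 ≤ p a) (hp1 : ∑ a, p a = 1)
    {v : α → ι → ℝ} (hv : ∀ a, v a ⬝ᵥ v a ≤ 1)
    (hE : ∑ a, p a • vecMulVec (v a) (v a) = (Fintype.card ι : ℝ)⁻¹ • (1 : Matrix ι ι ℝ))
    (hd : 2 ≤ Fintype.card ι) {ε : ℝ} (hε : 0 < ε) (hε1 : ε < 1) {q : ℕ}
    (hq : 20 * (Fintype.card ι * Real.log (Fintype.card ι) / ε ^ 2) ≤ q) :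
    probSeq p q {ω | ¬ ∀ x, (1 - ε) * (q / Fintype.card ι) * (x ⬝ᵥ x) ≤
      x ⬝ᵥ sampleSum v ω *ᵥ x} ≤ 1 / 2 := by
  set d : ℝ := (Fintype.card ι : ℝ) with hdd
  have hd2 : (2 : ℝ) ≤ d := by rw [hdd]; exact_mod_cast hd
  have hd0 : 0 < d := by linarith
  have hlog2 : (1 : ℝ) / 2 ≤ Real.log d := by
    have h1 := Real.log_two_gt_d9
    have h2 := Real.log_le_log (by norm_num) hd2
    linarith
  have hlog2d : Real.log (2 * d) ≤ 2 * Real.log d := by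
    rw [Real.log_mul (by norm_num) hd0.ne']
    linarith [Real.log_le_log (by norm_num) hd2]
  have hlogpos : 0 < Real.log (2 * d) := Real.log_pos (by linarith)
  -- The exponent makes the loss `(2 d) ^ (1 / P)` of Markov's inequality at most `1 + ε / 4`; the
  -- shift `a` makes the rank-one steps lose only a factor `1 - ε / 2`.
  set P : ℕ := ⌈8 * Real.log (2 * d) / ε⌉₊ with hPdef
  have hPlow : 8 * Real.log (2 * d) / ε ≤ P := Nat.le_ceil _
  have hPhigh : (P : ℝ) < 8 * Real.log (2 * d) / ε + 1 := Nat.ceil_lt_add_one (by positivity)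
  have hP0 : P ≠ 0 := by
    have : 0 < 8 * Real.log (2 * d) / ε := by positivity
    intro h
    rw [h, Nat.cast_zero] at hPlow
    linarith
  set a : ℝ := (P + 1) / ε with ha_def
  have hP1 : (0 : ℝ) < P + 1 := by positivity
  have ha : 0 < a := by positivity
  have haP : P + 1 ≤ a := by
    rw [ha_def, le_div_iff₀ hε]
    nlinarith
  set r : ℝ := q / d with hr
  have har : a ≤ r := by
    have h1 : 20 * Real.log d / ε ^ 2 ≤ r := by
      rw [hr, le_div_iff₀ hd0]
      calc _ = 20 * (d * Real.log d / ε ^ 2) := by ring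
        _ ≤ q := hq
    refine le_trans ?_ h1
    rw [ha_def, div_le_div_iff₀ hε (by positivity)]
    have h2 : (P + 1) * ε ≤ 20 * Real.log d := by
      have h3 : (P : ℝ) * ε < 8 * Real.log (2 * d) + ε := by
        calc (P : ℝ) * ε < (8 * Real.log (2 * d) / ε + 1) * ε := mul_lt_mul_of_pos_right hPhigh hε
          _ = _ := by field_simp
      nlinarith
    nlinarith
  have hc : (1 - ε / 2 : ℝ) = 1 - (P + 1) / (2 * a) := by
    rw [ha_def]
    field_simp
  have hX := expectSeq_trace_inv_pow_le hp hp1 hv hE P haP hc q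
  set X : (Fin q → α) → ℝ := fun ω => ((a • (1 : Matrix ι ι ℝ) + sampleSum v ω)⁻¹ ^ P).trace
  have hXnn : ∀ ω, 0 ≤ X ω := fun ω =>
    ((posDef_smul_one_add ha (posSemidef_sampleSum v ω)).inv.posSemidef.pow P).trace_nonneg
  refine le_trans (probSeq_mono hp ?_) (probSeq_mul_expectSeq_lt_le hp hXnn two_pos)
  intro ω hω
  by_contra hcon
  refine hω ?_
  have hXω : X ω ≤ 2 * expectSeq p q X := not_lt.1 hcon
  set s : ℝ := a + (1 - ε / 2) * q / d with hs
  set τ : ℝ := a + (1 - ε) * r with hτ_def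
  have hτ : 0 < τ := by
    have : 0 ≤ (1 - ε) * r := mul_nonneg (by linarith) (by linarith)
    linarith
  have hsτ : (1 + ε / 4) * τ ≤ s := by
    have e1 : s = a + (1 - ε / 2) * r := by rw [hs, hr]; ring
    have e2 : τ ≤ 2 * r := by
      rw [hτ_def]; nlinarith
    rw [e1]
    have : s - τ = ε / 2 * r := by rw [e1, hτ_def]; ring
    nlinarith
  have hexp : Real.exp (ε / 8) ≤ 1 + ε / 4 := by
    have h1 := Real.exp_bound_div_one_sub_of_interval (x := ε / 8) (by linarith) (by linarith)
    refine h1.trans ?_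
    rw [div_le_iff₀ (by linarith)]
    nlinarith
  have h2d : 2 * d ≤ (1 + ε / 4) ^ P := by
    calc 2 * d = Real.exp (Real.log (2 * d)) := (Real.exp_log (by linarith)).symm
      _ ≤ Real.exp (P * (ε / 8)) := by
          apply Real.exp_le_exp.2
          rw [div_le_iff₀ hε] at hPlow
          linarith
      _ = Real.exp (ε / 8) ^ P := Real.exp_nat_mul _ _
      _ ≤ _ := pow_le_pow_left₀ (Real.exp_pos _).le hexp P
  have hs0 : 0 < s := lt_of_lt_of_le (by positivity) hsτ
  have htr : X ω ≤ τ⁻¹ ^ P := by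
    have h1 : (1 + ε / 4) ^ P * s⁻¹ ^ P ≤ τ⁻¹ ^ P := by
      rw [← mul_pow]
      refine pow_le_pow_left₀ (by positivity) ?_ P
      rw [← div_eq_mul_inv, div_le_iff₀ hs0, inv_mul_eq_div, le_div_iff₀ hτ]
      exact hsτ
    have h2 : 2 * d * s⁻¹ ^ P ≤ (1 + ε / 4) ^ P * s⁻¹ ^ P := by gcongr
    linarith
  intro x
  have := le_quadForm_of_trace_inv_pow_le (posDef_smul_one_add ha (posSemidef_sampleSum v ω))
    hτ hP0 htr x
  rw [quadForm_smul_one_add, hτ_def] at this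
  linarith

end ChernoffTail

/-! ### Sampling rank-one matrices by their leverage scores -/

section LeverageSampling

variable {ι : Type*} [Fintype ι]

theorem whiten_vecMulVec (W : Matrix ι ι ℝ) (g : ι → ℝ) :
    vecMulVec (W *ᵥ g) (W *ᵥ g) = W * vecMulVec g g * Wᵀ := by
  rw [mul_vecMulVec, vecMulVec_mul, vecMul_transpose]

variable [DecidableEq ι]

/-- An inverse square root `W` of `M`, up to an orthogonal factor. -/
theorem exists_whitening {M : Matrix ι ι ℝ} (hM : M.PosDef) :
    ∃ W : Matrix ι ι ℝ, Wᵀ * W = M⁻¹ ∧ W * M * Wᵀ = 1 := by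
  have hMu := (Matrix.isUnit_iff_isUnit_det M).1 hM.isUnit
  have hB := hM.inv.posSemidef
  obtain ⟨U, -, -, hk⟩ := exists_diagonalization hB.isHermitian
  have hk1 := hk 1
  simp only [pow_one] at hk1
  set W := diagonal (fun i => √(hB.isHermitian.eigenvalues i)) * Uᵀ with hW
  have hWW : Wᵀ * W = M⁻¹ := by
    rw [hk1, hW, transpose_mul, transpose_transpose, diagonal_transpose, Matrix.mul_assoc,
      ← Matrix.mul_assoc (diagonal _) (diagonal _), diagonal_mul_diagonal, ← Matrix.mul_assoc]
    simp only [Real.mul_self_sqrt (hB.eigenvalues_nonneg _)]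
  refine ⟨W, hWW, ?_⟩
  have h1 : (M * Wᵀ) * W = 1 := by rw [Matrix.mul_assoc, hWW, mul_nonsing_inv _ hMu]
  rw [Matrix.mul_assoc]
  exact mul_eq_one_comm.1 h1

variable {α : Type*} [Fintype α]

theorem sum_leverage_div_card [Nonempty ι] {g : α → ι → ℝ} {M : Matrix ι ι ℝ} (hM : M.PosDef)
    (hg : M = ∑ a, vecMulVec (g a) (g a)) :
    ∑ a, (g a ⬝ᵥ M⁻¹ *ᵥ g a) / Fintype.card ι = 1 := by
  have hd : (Fintype.card ι : ℝ) ≠ 0 := by exact_mod_cast Fintype.card_ne_zero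
  have hMu := (Matrix.isUnit_iff_isUnit_det M).1 hM.isUnit
  rw [← Finset.sum_div, div_eq_one_iff_eq hd, ← trace_one (R := ℝ), ← nonsing_inv_mul _ hMu]
  nth_rewrite 3 [hg]
  rw [Matrix.mul_sum, trace_sum]
  exact Finset.sum_congr rfl fun a _ => (trace_mul_vecMulVec_self _ _).symm

/-- If `M = ∑ g gᵀ` and vectors are drawn with probabilities proportional to their leverage scores
`gᵀ M⁻¹ g`, then with probability at least one half the importance-weighted sum of the drawn
`g gᵀ` is at least `(1 - ε) M`. -/
theorem probSeq_leverage_sampling_le [Nonempty ι] {g : α → ι → ℝ} {M : Matrix ι ι ℝ}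
    (hM : M.PosDef) (hg : M = ∑ a, vecMulVec (g a) (g a)) {p : α → ℝ}
    (hp : ∀ a, p a = (g a ⬝ᵥ M⁻¹ *ᵥ g a) / Fintype.card ι)
    (hd : 2 ≤ Fintype.card ι) {ε : ℝ} (hε : 0 < ε) (hε1 : ε < 1) {q : ℕ}
    (hq : 20 * (Fintype.card ι * Real.log (Fintype.card ι) / ε ^ 2) ≤ q) :
    probSeq p q {ω | ¬ ∀ y, (1 - ε) * (y ⬝ᵥ M *ᵥ y) ≤
      ∑ k, (q * p (ω k))⁻¹ * (g (ω k) ⬝ᵥ y) ^ 2} ≤ 1 / 2 := by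
  obtain ⟨W, hWW, hWM⟩ := exists_whitening hM
  have hMu := (Matrix.isUnit_iff_isUnit_det M).1 hM.isUnit
  have hd0 : (0 : ℝ) < Fintype.card ι := by exact_mod_cast Fintype.card_pos
  have hlev : ∀ a, 0 ≤ g a ⬝ᵥ M⁻¹ *ᵥ g a := fun a => quadForm_nonneg hM.inv.posSemidef _
  have hp0 : ∀ a, 0 ≤ p a := fun a => by rw [hp]; exact div_nonneg (hlev a) hd0.le
  have hp1 : ∑ a, p a = 1 := by
    simp only [hp]
    exact sum_leverage_div_card hM hg
  have hdp : ∀ a, Fintype.card ι * p a = g a ⬝ᵥ M⁻¹ *ᵥ g a := fun a => by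
    rw [hp]; field_simp
  have hdp0 : ∀ a, 0 ≤ Fintype.card ι * p a := fun a => by rw [hdp]; exact hlev a
  have hq0 : (0 : ℝ) < q := by
    refine lt_of_lt_of_le ?_ hq
    have : 0 < Real.log (Fintype.card ι) := Real.log_pos (by exact_mod_cast hd)
    positivity
  have hWdot : ∀ x y : ι → ℝ, (W *ᵥ x) ⬝ᵥ (W *ᵥ y) = x ⬝ᵥ M⁻¹ *ᵥ y := fun x y => by
    rw [← hWW, ← mulVec_mulVec, dotProduct_mulVec x, vecMul_transpose]
  have hMM : ∀ y : ι → ℝ, M⁻¹ *ᵥ M *ᵥ y = y := fun y => by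
    rw [mulVec_mulVec, nonsing_inv_mul _ hMu, one_mulVec]
  -- The normalized vectors; those with `p a = 0` are zero, by the convention `0⁻¹ = 0`.
  set v : α → ι → ℝ := fun a => (√(Fintype.card ι * p a))⁻¹ • (W *ᵥ g a) with hv
  have hsq : ∀ a, (√(Fintype.card ι * p a))⁻¹ * (√(Fintype.card ι * p a))⁻¹ =
      (Fintype.card ι * p a)⁻¹ := fun a => by
    rw [← mul_inv, Real.mul_self_sqrt (hdp0 a)]
  have hv1 : ∀ a, v a ⬝ᵥ v a ≤ 1 := fun a => by
    have h1 : (W *ᵥ g a) ⬝ᵥ (W *ᵥ g a) = Fintype.card ι * p a := by rw [hdp, hWdot]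
    simp only [hv, smul_dotProduct, dotProduct_smul, smul_eq_mul]
    rw [h1, ← mul_assoc, hsq]
    exact inv_mul_le_one
  have hE : ∑ a, p a • vecMulVec (v a) (v a) =
      (Fintype.card ι : ℝ)⁻¹ • (1 : Matrix ι ι ℝ) := by
    have h1 : ∀ a, p a • vecMulVec (v a) (v a) =
        (Fintype.card ι : ℝ)⁻¹ • (W * vecMulVec (g a) (g a) * Wᵀ) := fun a => by
      simp only [hv, smul_vecMulVec, vecMulVec_smul, smul_smul]
      rw [hsq, whiten_vecMulVec]
      rcases (hp0 a).eq_or_lt with h0 | h0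
      · have : g a = 0 := by
          by_contra hne
          have := hM.inv.dotProduct_mulVec_pos hne
          rw [star_trivial, ← hdp, ← h0, mul_zero] at this
          exact lt_irrefl _ this
        simp [this]
      · congr 1
        field_simp
    rw [Finset.sum_congr rfl fun a _ => h1 a, ← Finset.smul_sum, ← Finset.sum_mul,
      ← Finset.mul_sum, ← hg, hWM]
  refine le_trans (probSeq_mono hp0 ?_) (probSeq_sampleSum_lt_le hp0 hp1 hv1 hE hd hε hε1 hq)
  intro ω hω hcon
  refine hω fun y => ?_
  have h1 := hcon (W *ᵥ M *ᵥ y)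
  have h2 : (W *ᵥ M *ᵥ y) ⬝ᵥ (W *ᵥ M *ᵥ y) = y ⬝ᵥ M *ᵥ y := by
    rw [hWdot, hMM, dotProduct_comm]
  have h3 : ∀ a, (v a ⬝ᵥ W *ᵥ M *ᵥ y) ^ 2 = (Fintype.card ι * p a)⁻¹ * (g a ⬝ᵥ y) ^ 2 := by
    intro a
    have : (W *ᵥ g a) ⬝ᵥ (W *ᵥ M *ᵥ y) = g a ⬝ᵥ y := by rw [hWdot, hMM]
    simp only [hv, smul_dotProduct, smul_eq_mul]
    rw [this, mul_pow, sq (√_)⁻¹, hsq]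
  rw [quadForm_sampleSum, h2, Finset.sum_congr rfl fun k _ => h3 (ω k)] at h1
  have h4 := mul_le_mul_of_nonneg_left h1 (div_nonneg hd0.le hq0.le)
  rw [Finset.mul_sum] at h4
  calc (1 - ε) * (y ⬝ᵥ M *ᵥ y)
      = Fintype.card ι / q * ((1 - ε) * (q / Fintype.card ι) * (y ⬝ᵥ M *ᵥ y)) := by
        field_simp
    _ ≤ _ := h4
    _ = _ := Finset.sum_congr rfl fun k _ => by
        rw [mul_inv, mul_inv]
        field_simp

end LeverageSampling

/-! ### Estimation measures of comparable information matrices -/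

section Measures

variable {ι : Type*} [Fintype ι] [DecidableEq ι]

theorem trace_le_of_quadForm_le {A B : Matrix ι ι ℝ} {c : ℝ}
    (h : ∀ x, x ⬝ᵥ A *ᵥ x ≤ c * (x ⬝ᵥ B *ᵥ x)) : A.trace ≤ c * B.trace := by
  rw [trace, trace, Finset.mul_sum]
  refine Finset.sum_le_sum fun i _ => ?_
  simpa using h (Pi.single i 1)

/-- After whitening by `Q`, the matrix `P` has eigenvalues at most `c`. -/
theorem det_le_of_quadForm_le {P Q : Matrix ι ι ℝ} (hP : P.PosDef) (hQ : Q.PosDef) {c : ℝ}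
    (h : ∀ x, x ⬝ᵥ P *ᵥ x ≤ c * (x ⬝ᵥ Q *ᵥ x)) : P.det ≤ c ^ Fintype.card ι * Q.det := by
  obtain ⟨W, hWW, hWQ⟩ := exists_whitening hQ
  have hN : (W * P * Wᵀ).PosSemidef := by
    have := hP.posSemidef.mul_mul_conjTranspose_same W
    rwa [conjTranspose_eq_transpose_of_trivial] at this
  have hform : ∀ (M : Matrix ι ι ℝ) x, x ⬝ᵥ (W * M * Wᵀ) *ᵥ x = (Wᵀ *ᵥ x) ⬝ᵥ M *ᵥ (Wᵀ *ᵥ x) := by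
    intro M x
    rw [← mulVec_mulVec, ← mulVec_mulVec, dotProduct_mulVec, ← mulVec_transpose]
  have heig := eigenvalues_le_of_quadForm_le hN.isHermitian (δ := c) fun x => by
    have h1 := hform Q x
    rw [hWQ, one_mulVec] at h1
    rw [hform, h1]
    exact h _
  have hdetN : (W * P * Wᵀ).det ≤ c ^ Fintype.card ι := by
    rw [hN.isHermitian.det_eq_prod_eigenvalues]
    calc _ ≤ ∏ _i : ι, c := Finset.prod_le_prod (fun i _ => hN.eigenvalues_nonneg i)
          (fun i _ => heig i)
      _ = _ := by simp
  have hdet : (W * P * Wᵀ).det * Q.det = P.det := by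
    have h1 : W.det * Q.det * W.det = 1 := by
      rw [← det_transpose W]
      nth_rewrite 1 [det_transpose W]
      rw [← det_mul, ← det_mul, hWQ, det_one]
    rw [det_mul, det_mul, det_transpose]
    calc _ = P.det * (W.det * Q.det * W.det) := by ring
      _ = _ := by rw [h1, mul_one]
  rw [← hdet]
  exact mul_le_mul_of_nonneg_right hdetN hQ.det_pos.le

theorem sSup_spectrum_le_of_quadForm_le [Nonempty ι] {A B : Matrix ι ι ℝ} (hA : A.IsHermitian)
    (hB : B.IsHermitian) {c : ℝ} (hc : 0 ≤ c) (h : ∀ x, x ⬝ᵥ A *ᵥ x ≤ c * (x ⬝ᵥ B *ᵥ x)) :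
    sSup (spectrum ℝ A) ≤ c * sSup (spectrum ℝ B) := by
  rw [hA.spectrum_real_eq_range_eigenvalues, hB.spectrum_real_eq_range_eigenvalues]
  refine csSup_le (Set.range_nonempty _) ?_
  rintro _ ⟨i, rfl⟩
  refine eigenvalues_le_of_quadForm_le hA (fun x => (h x).trans ?_) i
  rw [mul_assoc]
  exact mul_le_mul_of_nonneg_left (quadForm_le_of_eigenvalues_le hB
    (fun j => le_csSup (Set.finite_range _).bddAbove (Set.mem_range_self j)) x) hc

theorem sSup_spectrum_pos [Nonempty ι] {A : Matrix ι ι ℝ} (hA : A.PosDef) :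
    0 < sSup (spectrum ℝ A) := by
  rw [hA.isHermitian.spectrum_real_eq_range_eigenvalues]
  exact (hA.eigenvalues_pos (Classical.arbitrary ι)).trans_le
    (le_csSup (Set.finite_range _).bddAbove (Set.mem_range_self _))

theorem measures_le_of_quadForm_le {n : ℕ} [NeZero n] {P Q : Matrix (Fin n) (Fin n) ℝ}
    (hP : P.PosDef) (hQ : Q.PosDef) {κ : ℝ} (hκ : 0 < κ)
    (h : ∀ x, x ⬝ᵥ P *ᵥ x ≤ κ * (x ⬝ᵥ Q *ᵥ x)) :
    (rhoVar Q - rhoVar P) / rhoVar P ≤ κ - 1 ∧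
      rhoEnt Q - rhoEnt P ≤ n * Real.log κ ∧
      (rhoMax Q - rhoMax P) / rhoMax P ≤ κ - 1 := by
  have hinv := inv_quadForm_le hP hQ hκ h
  have hrel : ∀ a b : ℝ, 0 < b → a ≤ κ * b → (a - b) / b ≤ κ - 1 := fun a b hb hab => by
    rw [div_le_iff₀ hb]
    linarith
  refine ⟨hrel _ _ hP.inv.trace_pos (trace_le_of_quadForm_le hinv), ?_,
    hrel _ _ (sSup_spectrum_pos hP.inv) (sSup_spectrum_le_of_quadForm_le hQ.inv.isHermitian
      hP.inv.isHermitian hκ.le hinv)⟩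
  have hdet := det_le_of_quadForm_le hQ.inv hP.inv hinv
  have hlog := Real.log_le_log hQ.inv.det_pos hdet
  rw [Real.log_mul (pow_pos hκ _).ne' hP.inv.det_pos.ne', Real.log_pow, Fintype.card_fin] at hlog
  rw [rhoEnt, rhoEnt]
  linarith

end Measures

/-! ### The information matrices of the features -/

section Features

theorem posSemidef_featureInformation {n m : ℕ} (σ : ℝ) (F : Matrix (Fin m) (Fin n) ℝ)
    (E : Matrix (Fin m) (Fin 3) ℝ) (hE : IsUnit (Eᵀ * E)) :
    (featureInformation σ F E).PosSemidef := by
  have hu := (Matrix.isUnit_iff_isUnit_det _).1 hE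
  -- `Q` is the orthogonal projection onto the range of `E`.
  set Q : Matrix (Fin m) (Fin m) ℝ := E * (Eᵀ * E)⁻¹ * Eᵀ with hQ
  have hQT : Qᵀ = Q := by
    simp only [hQ, transpose_mul, transpose_transpose, transpose_nonsing_inv, Matrix.mul_assoc]
  have hQQ : Q * Q = Q := by
    calc Q * Q = E * (Eᵀ * E)⁻¹ * ((Eᵀ * E) * (Eᵀ * E)⁻¹) * Eᵀ := by
          simp only [hQ, Matrix.mul_assoc]
      _ = Q := by rw [mul_nonsing_inv _ hu, Matrix.mul_one]
  have h1 : Fᵀ * F - Fᵀ * E * (Eᵀ * E)⁻¹ * Eᵀ * F = (F - Q * F)ᵀ * (F - Q * F) := by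
    have e1 : Fᵀ * E * (Eᵀ * E)⁻¹ * Eᵀ * F = Fᵀ * (Q * F) := by
      simp only [hQ, Matrix.mul_assoc]
    have e2 : (Q * F)ᵀ = Fᵀ * Q := by rw [transpose_mul, hQT]
    rw [e1, transpose_sub, e2, Matrix.sub_mul, Matrix.mul_sub, Matrix.mul_sub,
      Matrix.mul_assoc Fᵀ Q F, Matrix.mul_assoc Fᵀ Q (Q * F), ← Matrix.mul_assoc Q Q F, hQQ]
    abel
  have h2 := posSemidef_conjTranspose_mul_self (F - Q * F)
  rw [conjTranspose_eq_transpose_of_trivial] at h2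
  rw [featureInformation, h1]
  exact h2.smul (inv_nonneg.2 (sq_nonneg σ))

variable {n : ℕ} {Θ : Type*} {H₀ : Matrix (Fin n) (Fin n) ℝ} {H : Θ → Matrix (Fin n) (Fin n) ℝ}

theorem posDef_infoMatrix (hH₀ : H₀.PosDef) (hH : ∀ f, (H f).PosSemidef) (Φ : Finset Θ) :
    (infoMatrix H₀ H Φ).PosDef :=
  hH₀.add_posSemidef (posSemidef_sum _ fun f _ => hH f)

theorem selected_eq_image [DecidableEq Θ] {q : ℕ} (ω : Fin q → Θ) :
    selected H₀ H ω = Finset.univ.image ω := by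
  have key : ∀ (l : List Θ) (s : Finset Θ × Matrix (Fin n) (Fin n) ℝ),
      (l.foldl (selectStep H) s).1 = s.1 ∪ l.toFinset := by
    intro l
    induction l with
    | nil => intro s; simp
    | cons f l ih =>
      intro s
      rw [List.foldl_cons, ih, List.toFinset_cons]
      unfold selectStep
      split_ifs with hf
      · rw [Finset.union_insert, Finset.insert_eq_of_mem (Finset.mem_union_left _ hf)]
      · rw [Finset.insert_union, Finset.union_insert]
  rw [selected, runSelection, key]
  ext f
  simp [List.mem_ofFn]

variable [Fintype Θ]

theorem sum_augmentedInfo [Nonempty Θ] :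
    ∑ f, augmentedInfo H₀ H f = infoMatrix H₀ H Finset.univ := by
  have hN : (Fintype.card Θ : ℝ) ≠ 0 := by exact_mod_cast Fintype.card_ne_zero
  simp only [augmentedInfo, infoMatrix, Finset.sum_add_distrib, Finset.sum_const, Finset.card_univ]
  rw [← Nat.cast_smul_eq_nsmul ℝ, smul_smul, mul_inv_cancel₀ hN, one_smul]

theorem posDef_augmentedInfo [Nonempty Θ] (hH₀ : H₀.PosDef) (hH : ∀ f, (H f).PosSemidef) (f : Θ) :
    (augmentedInfo H₀ H f).PosDef := by
  have hN : (0 : ℝ) < Fintype.card Θ := by exact_mod_cast Fintype.card_pos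
  exact (hH₀.smul (inv_pos.2 hN)).add_posSemidef (hH f)

theorem sum_quadForm_augmentedInfo_le [Nonempty Θ] (hH₀ : H₀.PosDef) (Φ : Finset Θ)
    (y : Fin n → ℝ) :
    ∑ f ∈ Φ, y ⬝ᵥ augmentedInfo H₀ H f *ᵥ y ≤ y ⬝ᵥ infoMatrix H₀ H Φ *ᵥ y := by
  have hN : (0 : ℝ) < Fintype.card Θ := by exact_mod_cast Fintype.card_pos
  have hcard : (Φ.card : ℝ) * (Fintype.card Θ : ℝ)⁻¹ ≤ 1 := by
    rw [← div_eq_mul_inv, div_le_one hN]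
    exact_mod_cast Finset.card_le_univ Φ
  have h0 := quadForm_nonneg hH₀.posSemidef y
  simp only [augmentedInfo, infoMatrix, add_mulVec, dotProduct_add, Finset.sum_add_distrib,
    Finset.sum_const, sum_mulVec, dotProduct_sum, smul_mulVec, dotProduct_smul, smul_eq_mul,
    nsmul_eq_mul]
  rw [← mul_assoc]
  have := mul_le_mul_of_nonneg_right hcard h0
  linarith

end Features

/-! ### Refined sampling and the number `χ` -/

section Refined

variable {n : ℕ} {Θ : Type*} [Fintype Θ] {H₀ : Matrix (Fin n) (Fin n) ℝ}
  {H : Θ → Matrix (Fin n) (Fin n) ℝ} {h : Θ → Fin n → Fin n → ℝ}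

theorem refinedProb_eq (a : Θ × Fin n) :
    refinedProb H₀ H h a =
      (h a.1 a.2 ⬝ᵥ (infoMatrix H₀ H Finset.univ)⁻¹ *ᵥ h a.1 a.2) / n := by
  rw [refinedProb, trace_mul_vecMulVec_self]

theorem sum_refinedProb (hdec : IsOrthogonalDecomposition H₀ H h) (f : Θ) :
    ∑ i, refinedProb H₀ H h (f, i) = samplingProb H₀ H f := by
  simp only [refinedProb, samplingProb, leverage]
  rw [(hdec f).2, Matrix.mul_sum, trace_sum, Finset.sum_div]

/-- Drawing first `f` and then `i` amounts to drawing the pair `(f, i)` with probability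
`refinedProb`. -/
theorem pairProb_eq (hdec : IsOrthogonalDecomposition H₀ H h)
    (hpos : ∀ f, samplingProb H₀ H f ≠ 0) : pairProb H₀ H h = refinedProb H₀ H h := by
  ext a
  rw [pairProb, sum_refinedProb hdec, mul_div_cancel₀ _ (hpos a.1)]

theorem samplingProb_pos [Nonempty Θ] [NeZero n] (hH₀ : H₀.PosDef) (hH : ∀ f, (H f).PosSemidef)
    (hdec : IsOrthogonalDecomposition H₀ H h) (f : Θ) : 0 < samplingProb H₀ H f := by
  have hn : (0 : ℝ) < n := by exact_mod_cast Nat.pos_of_ne_zero (NeZero.ne n)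
  have hM := (posDef_infoMatrix hH₀ hH Finset.univ).inv
  rw [← sum_refinedProb hdec]
  have h0 : ∀ i, 0 ≤ refinedProb H₀ H h (f, i) := fun i => by
    rw [refinedProb_eq]
    exact div_nonneg (quadForm_nonneg hM.posSemidef _) hn.le
  refine (Finset.sum_nonneg fun i _ => h0 i).lt_of_ne fun hz => ?_
  have hz' := (Finset.sum_eq_zero_iff_of_nonneg fun i _ => h0 i).1 hz.symm
  have hh : ∀ i, h f i = 0 := fun i => by
    by_contra hne
    have h1 := hz' i (Finset.mem_univ i)
    have h2 := hM.dotProduct_mulVec_pos hne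
    rw [refinedProb_eq, div_eq_zero_iff] at h1
    rcases h1 with h1 | h1
    · rw [star_trivial, h1] at h2
      exact lt_irrefl _ h2
    · exact hn.ne' h1
  have hA := (posDef_augmentedInfo hH₀ hH f).trace_pos
  rw [(hdec f).2] at hA
  simp [hh] at hA

variable [DecidableEq Θ] {q : ℕ}

/-- The importance-weighted sum over the draws, grouped by the pairs drawn. -/
theorem sum_weight_mul (ω : Fin q → Θ × Fin n) (z : Θ × Fin n → ℝ) :
    ∑ a ∈ Finset.univ.image ω, weight H₀ H h ω a * z a =
      ∑ k, (q * refinedProb H₀ H h (ω k))⁻¹ * z (ω k) := by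
  rw [← Finset.sum_fiberwise_of_maps_to (g := ω) (t := Finset.univ.image ω)
    fun k hk => Finset.mem_image_of_mem ω hk]
  refine Finset.sum_congr rfl fun a _ => ?_
  rw [Finset.sum_congr rfl (g := fun _ => (q * refinedProb H₀ H h a)⁻¹ * z a)
    fun k hk => by rw [(Finset.mem_filter.1 hk).2], Finset.sum_const, nsmul_eq_mul, weight]
  ring

theorem chi_nonneg (ω : Fin q → Θ × Fin n) : 0 ≤ chi H₀ H h ω :=
  Real.sInf_nonneg fun _ hγ => hγ.1.le

theorem weight_nonneg (hr : ∀ a, 0 ≤ refinedProb H₀ H h a) (ω : Fin q → Θ × Fin n)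
    (a : Θ × Fin n) : 0 ≤ weight H₀ H h ω a :=
  mul_nonneg (Nat.cast_nonneg _) (inv_nonneg.2 (mul_nonneg (Nat.cast_nonneg _) (hr a)))

/-- By Cauchy–Schwarz, `∑ w² h hᵀ ≤ γ ∑ w h hᵀ` implies `∑ w h hᵀ ≤ γ ∑ h hᵀ`, so passing from the
weighted to the unweighted sum over the pairs drawn costs the factor `χ`. -/
theorem sum_weight_mul_sq_le_chi_mul (hr : ∀ a, 0 ≤ refinedProb H₀ H h a)
    (ω : Fin q → Θ × Fin n) (y : Fin n → ℝ) :
    ∑ a ∈ Finset.univ.image ω, weight H₀ H h ω a * (h a.1 a.2 ⬝ᵥ y) ^ 2 ≤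
      chi H₀ H h ω * ∑ a ∈ Finset.univ.image ω, (h a.1 a.2 ⬝ᵥ y) ^ 2 := by
  set s := Finset.univ.image ω with hs
  set w := weight H₀ H h ω with hw
  set z : Θ × Fin n → ℝ := fun a => h a.1 a.2 ⬝ᵥ y with hz
  have hw0 : ∀ a, 0 ≤ w a := weight_nonneg hr ω
  set T : Set ℝ := {γ : ℝ | 0 < γ ∧
    (∑ a ∈ s, (w a * (γ - w a)) • vecMulVec (h a.1 a.2) (h a.1 a.2)).PosSemidef} with hT
  have hchi : chi H₀ H h ω = sInf T := rfl
  have hS0 : 0 ≤ ∑ a ∈ s, w a * z a ^ 2 :=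
    Finset.sum_nonneg fun a _ => mul_nonneg (hw0 a) (sq_nonneg _)
  have hQ0 : 0 ≤ ∑ a ∈ s, z a ^ 2 := Finset.sum_nonneg fun a _ => sq_nonneg _
  have hmem : ∀ γ ∈ T, ∑ a ∈ s, w a * z a ^ 2 ≤ γ * ∑ a ∈ s, z a ^ 2 := by
    rintro γ ⟨hγ0, hγ⟩
    have h1 := quadForm_nonneg hγ y
    simp only [sum_mulVec, dotProduct_sum, smul_mulVec, dotProduct_smul, quadForm_vecMulVec,
      smul_eq_mul] at h1
    have h2 : ∑ a ∈ s, (w a * z a) ^ 2 ≤ γ * ∑ a ∈ s, w a * z a ^ 2 := by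
      rw [← sub_nonneg, Finset.mul_sum, ← Finset.sum_sub_distrib]
      refine h1.trans_eq (Finset.sum_congr rfl fun a _ => ?_)
      simp only [hz]
      ring
    have h3 := Finset.sum_mul_sq_le_sq_mul_sq s (fun a => w a * z a) z
    rw [Finset.sum_congr rfl fun a _ => show w a * z a * z a = w a * z a ^ 2 by ring] at h3
    rcases hS0.eq_or_lt with h0 | h0
    · rw [← h0]
      exact mul_nonneg hγ0.le hQ0
    · refine le_of_mul_le_mul_left ?_ h0
      calc _ = (∑ a ∈ s, w a * z a ^ 2) ^ 2 := by ring
        _ ≤ _ := h3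
        _ ≤ (γ * ∑ a ∈ s, w a * z a ^ 2) * ∑ a ∈ s, z a ^ 2 :=
          mul_le_mul_of_nonneg_right h2 hQ0
        _ = _ := by ring
  have hne : T.Nonempty := by
    have hsum : 0 ≤ ∑ a ∈ s, w a := Finset.sum_nonneg fun a _ => hw0 a
    refine ⟨1 + ∑ a ∈ s, w a, by linarith, posSemidef_sum _ fun a ha => ?_⟩
    refine (posSemidef_vecMulVec _).smul (mul_nonneg (hw0 a) ?_)
    have := Finset.single_le_sum (fun a _ => hw0 a) ha
    linarith
  rw [hchi]
  rcases hQ0.eq_or_lt with h0 | h0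
  · obtain ⟨γ, hγ⟩ := hne
    have := hmem γ hγ
    rw [← h0, mul_zero] at this ⊢
    exact this
  · rw [← div_le_iff₀ h0]
    exact le_csInf hne fun γ hγ => (div_le_iff₀ h0).2 (hmem γ hγ)

/-- The vectors of the pairs drawn carry at most the information of the features drawn. -/
theorem sum_sq_le_quadForm_infoMatrix [Nonempty Θ] (hH₀ : H₀.PosDef)
    (hdec : IsOrthogonalDecomposition H₀ H h) (ω : Fin q → Θ × Fin n) (y : Fin n → ℝ) :
    ∑ a ∈ Finset.univ.image ω, (h a.1 a.2 ⬝ᵥ y) ^ 2 ≤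
      y ⬝ᵥ infoMatrix H₀ H (selected H₀ H fun k => (ω k).1) *ᵥ y := by
  refine le_trans ?_ (sum_quadForm_augmentedInfo_le hH₀ _ y)
  rw [selected_eq_image]
  calc ∑ a ∈ Finset.univ.image ω, (h a.1 a.2 ⬝ᵥ y) ^ 2
      ≤ ∑ a ∈ (Finset.univ.image fun k => (ω k).1) ×ˢ Finset.univ, (h a.1 a.2 ⬝ᵥ y) ^ 2 := by
        refine Finset.sum_le_sum_of_subset_of_nonneg (fun a ha => ?_) fun _ _ _ => sq_nonneg _
        obtain ⟨k, -, rfl⟩ := Finset.mem_image.1 ha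
        simp
    _ = _ := by
        rw [Finset.sum_product]
        refine Finset.sum_congr rfl fun f _ => ?_
        rw [(hdec f).2, sum_mulVec, dotProduct_sum]
        exact Finset.sum_congr rfl fun i _ => (quadForm_vecMulVec _ _).symm

end Refined

end FeatureSelection

theorem theorem2 :
    ∃ C : ℝ, 0 < C ∧
      ∀ (n : ℕ) (_ : 2 ≤ n) (Θ : Type*) [Fintype Θ] [DecidableEq Θ] [Nonempty Θ]
        (H₀ : Matrix (Fin n) (Fin n) ℝ) (_ : H₀.PosDef)
        (σ : ℝ) (_ : 0 < σ) (m : Θ → ℕ)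
        (F : (f : Θ) → Matrix (Fin (m f)) (Fin n) ℝ)
        (E : (f : Θ) → Matrix (Fin (m f)) (Fin 3) ℝ)
        (_ : ∀ f, IsUnit ((E f).transpose * E f))
        (H : Θ → Matrix (Fin n) (Fin n) ℝ)
        (_ : ∀ f, H f = FeatureSelection.featureInformation σ (F f) (E f))
        (h : Θ → Fin n → Fin n → ℝ)
        (_ : FeatureSelection.IsOrthogonalDecomposition H₀ H h)
        (ε : ℝ) (_ : 0 < ε) (_ : ε < 1)
        (q : ℕ) (_ : C * (n * Real.log n / ε ^ 2) ≤ q),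
        1 / 4 ≤ FeatureSelection.probSeq (FeatureSelection.samplingProb H₀ H) q
          {ω |
            let HΘ := FeatureSelection.infoMatrix H₀ H Finset.univ
            let HΦ := FeatureSelection.infoMatrix H₀ H (FeatureSelection.selected H₀ H ω)
            let κ := 4 * FeatureSelection.chiBar H₀ H h q / (1 - ε)
            (FeatureSelection.rhoVar HΦ - FeatureSelection.rhoVar HΘ)
                / FeatureSelection.rhoVar HΘ ≤ κ - 1 ∧
            FeatureSelection.rhoEnt HΦ - FeatureSelection.rhoEnt HΘ ≤ n * Real.log κ ∧
            (FeatureSelection.rhoMax HΦ - FeatureSelection.rhoMax HΘ)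
                / FeatureSelection.rhoMax HΘ ≤ κ - 1} := by
  refine ⟨20, by norm_num, ?_⟩
  intro n hn Θ _ _ _ H₀ hH₀ σ _ m F E hE H hHf h hdec ε hε hε1 q hq
  have : NeZero n := ⟨by omega⟩
  have hH : ∀ f, (H f).PosSemidef := fun f => by
    rw [hHf]
    exact FeatureSelection.posSemidef_featureInformation σ (F f) (E f) (hE f)
  have hM := FeatureSelection.posDef_infoMatrix hH₀ hH Finset.univ
  have hg : FeatureSelection.infoMatrix H₀ H Finset.univ =
      ∑ a : Θ × Fin n, vecMulVec (h a.1 a.2) (h a.1 a.2) := by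
    rw [← FeatureSelection.sum_augmentedInfo, Fintype.sum_prod_type]
    exact Finset.sum_congr rfl fun f _ => (hdec f).2
  have hpair := FeatureSelection.pairProb_eq hdec
    fun f => (FeatureSelection.samplingProb_pos hH₀ hH hdec f).ne'
  set r := FeatureSelection.refinedProb H₀ H h with hr
  have hreq : ∀ a : Θ × Fin n, r a =
      (h a.1 a.2 ⬝ᵥ (FeatureSelection.infoMatrix H₀ H Finset.univ)⁻¹ *ᵥ h a.1 a.2)
        / Fintype.card (Fin n) := fun a => by
    rw [Fintype.card_fin]
    exact FeatureSelection.refinedProb_eq a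
  have hr0 : ∀ a, 0 ≤ r a := fun a => by
    rw [hreq]
    exact div_nonneg (FeatureSelection.quadForm_nonneg hM.inv.posSemidef _) (Nat.cast_nonneg _)
  have hr1 : ∑ a, r a = 1 := by
    simp only [hreq]
    exact FeatureSelection.sum_leverage_div_card hM hg
  -- The draws of pairs for which the weighted sum is too small, or `χ` exceeds `4 χ̄`.
  have hbad1 := FeatureSelection.probSeq_leverage_sampling_le hM hg hreq (by simpa using hn) hε hε1
    (q := q) (by simpa using hq)
  have hbad2 := FeatureSelection.probSeq_mul_expectSeq_lt_le (q := q) hr0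
    (X := FeatureSelection.chi H₀ H h) FeatureSelection.chi_nonneg (c := 4) (by norm_num)
  have hchiBar : FeatureSelection.expectSeq r q (FeatureSelection.chi H₀ H h) =
      FeatureSelection.chiBar H₀ H h q := by rw [FeatureSelection.chiBar, hpair]
  rw [hchiBar] at hbad2
  rw [← FeatureSelection.probSeq_fst_preimage (FeatureSelection.sum_refinedProb hdec), ← hr]
  refine (show (1 / 4 : ℝ) ≤ 1 - 1 / 2 - 1 / 4 by norm_num).trans
    (FeatureSelection.one_sub_sub_le_probSeq hr0 hr1 hbad1 hbad2 fun ω h1 h2 => ?_)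
  have hweighted := not_not.1 h1
  have hchi : FeatureSelection.chi H₀ H h ω ≤ 4 * FeatureSelection.chiBar H₀ H h q := not_lt.1 h2
  have hQ := FeatureSelection.posDef_infoMatrix hH₀ hH
    (FeatureSelection.selected H₀ H fun k => (ω k).1)
  have hε' : 0 < 1 - ε := by linarith
  have hle : ∀ y, y ⬝ᵥ FeatureSelection.infoMatrix H₀ H Finset.univ *ᵥ y ≤
      4 * FeatureSelection.chiBar H₀ H h q / (1 - ε) *
        (y ⬝ᵥ FeatureSelection.infoMatrix H₀ H
          (FeatureSelection.selected H₀ H fun k => (ω k).1) *ᵥ y) := fun y => by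
    have e1 := hweighted y
    rw [← FeatureSelection.sum_weight_mul ω fun a => (h a.1 a.2 ⬝ᵥ y) ^ 2] at e1
    have e2 := FeatureSelection.sum_weight_mul_sq_le_chi_mul hr0 ω y
    have e3 := FeatureSelection.sum_sq_le_quadForm_infoMatrix hH₀ hdec ω y
    rw [div_mul_eq_mul_div, le_div_iff₀ hε', mul_comm _ (1 - ε)]
    refine (e1.trans e2).trans (mul_le_mul hchi e3 (Finset.sum_nonneg fun _ _ => sq_nonneg _) ?_)
    exact (FeatureSelection.chi_nonneg ω).trans hchi
  -- Positivity of `χ̄` comes for free, both matrices being positive definite.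
  have hκ : 0 < 4 * FeatureSelection.chiBar H₀ H h q / (1 - ε) := by
    have hone : (1 : Fin n → ℝ) ≠ 0 := one_ne_zero
    have e1 := hM.dotProduct_mulVec_pos hone
    have e2 := hQ.dotProduct_mulVec_pos hone
    rw [star_trivial] at e1 e2
    exact pos_of_mul_pos_left (e1.trans_le (hle 1)) e2.le
  exact FeatureSelection.measures_le_of_quadForm_le hM hQ hκ hle
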